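/- For $N\ge 1$, the flavored Schur index of $U(N)$ $\mathcal N=4$ super-Yang--Mills theory is the function of the fugacities $x\in\mathbb C$, $b\in\mathbb C\setminus\{0\}$ with $|bx|<1$, $|b^{-1}x|<1$ given by the unitary matrix integral, written over the eigenvalues $e^{2\pi i u_a}$, $$I_N(x;b)=\frac1{N!}\int_{[-\frac12,\frac12]^N}\prod_{a=1}^N du_a\prod_{a<c}\bigl(2\sin\pi(u_a-u_c)\bigr)^2\exp\Bigl[\sum_{n=1}^\infty\frac1n\,\iota(x^n,b^n)\sum_{a,c=1}^N e^{2\pi i n(u_a-u_c)}\Bigr],$$ $$\iota(x,b)=1-\frac{(1-bx)(1-b^{-1}x)}{1-x^2}.$$ **Theorem.** The flavored Schur index is log-linearly bounded. That is, each $I_N$ is the sum of a series $\sum_{p\ge0}\bigl(\sum_{q\in\mathbb Z} a_N(p;q)\,b^q\bigr)x^p$ in $\mathbb Z[b,b^{-1}][[x]]$ (for each $p$ only finitely many $a_N(p;q)$ are nonzero), convergent for all such $x,b$; and, with the cumulative absolute degeneracies $$A_N(P)=\sum_{p\le P}\ \sum_{q\in\mathbb Z}|a_N(p;q)|,$$ for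 any pair of real numbers $\alpha,\varepsilon>0$ there exists $N_0\in\mathbb Z_{>0}$ such that $$\log A_N\bigl(\lfloor\alpha N^2\rfloor\bigr)<N^{1+\varepsilon}\qquad\text{for all } N>N_0 .$$ -/

import Mathlib

open scoped Nat LaurentPolynomial

noncomputable section

/-- A partition series with one one-sided fugacity `x` and one two-sided fugacity `b`,
that is, an element of `ℤ[b, b⁻¹][[x]]`. -/
abbrev PartitionSeries : Type := PowerSeries (LaurentPolynomial ℤ)

namespace PartitionSeries

/-- The coefficient (signed degeneracy) `a(p; q)` of `x ^ p * b ^ q`. -/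
def degeneracy (A : PartitionSeries) (p : ℕ) (q : ℤ) : ℤ :=
  (PowerSeries.coeff p A).coeff q

/-- The cumulative absolute degeneracy: the sum of `|a(p; q)|` over all `p ≤ P` and all `q`
(for each `p` only finitely many `q` contribute). -/
def cumulative (A : PartitionSeries) (P : ℕ) : ℕ :=
  ∑ p ∈ Finset.range (P + 1), ∑ q ∈ (PowerSeries.coeff p A).coeff.support, (A.degeneracy p q).natAbs

/-- A family of partition series, indexed by the rank `N ≥ 1`, is log-linearly bounded
(the member with index `0` plays no role). -/
def IsLogLinearlyBounded (A : ℕ → PartitionSeries) : Prop :=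
  ∀ α ε : ℝ, 0 < α → 0 < ε → ∃ N₀ : ℕ, 0 < N₀ ∧ ∀ N : ℕ, N₀ < N →
    Real.log ((A N).cumulative ⌊α * (N : ℝ) ^ 2⌋₊ : ℝ) < (N : ℝ) ^ (1 + ε)

end PartitionSeries

namespace FlavoredSchur

/-- The single-letter flavored Schur index `1 - (1 - b x) (1 - b⁻¹ x) / (1 - x ^ 2)`. -/
def singleLetter (x b : ℂ) : ℂ :=
  1 - (1 - b * x) * (1 - b⁻¹ * x) / (1 - x ^ 2)

/-- The exponent of the matrix integral at the unitary matrix with eigenvalues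
`exp (2 π i u_a)`: the sum over `n ≥ 1` of
`(1 / n) * ι (x ^ n, b ^ n) * ∑_{a, c} exp (2 π i n (u_a - u_c))`. -/
def exponent (N : ℕ) (x b : ℂ) (u : Fin N → ℝ) : ℂ :=
  ∑' n : ℕ, (1 / ((n : ℂ) + 1)) * singleLetter (x ^ (n + 1)) (b ^ (n + 1)) *
    ∑ a : Fin N, ∑ c : Fin N,
      Complex.exp (2 * Real.pi * Complex.I * ((n : ℂ) + 1) * ((u a - u c : ℝ) : ℂ))

/-- The squared Vandermonde factor `∏_{a < c} (2 sin (π (u_a - u_c))) ^ 2`. -/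
def vandermonde (N : ℕ) (u : Fin N → ℝ) : ℝ :=
  ∏ a : Fin N, ∏ c ∈ Finset.Ioi a, (2 * Real.sin (Real.pi * (u a - u c))) ^ 2

/-- The flavored Schur index of the `U(N)` theory as a function of the fugacities `x`, `b`:
the unitary matrix integral, written over the eigenvalues `exp (2 π i u_a)`,
`u_a ∈ [-1/2, 1/2]`. -/
def index (N : ℕ) (x b : ℂ) : ℂ :=
  (1 / (N ! : ℂ)) *
    ∫ u : Fin N → ℝ in Set.Icc (fun _ => -(1 / 2 : ℝ)) (fun _ => (1 / 2 : ℝ)),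
      (vandermonde N u : ℂ) * Complex.exp (exponent N x b u)

/-- `A` is the expansion of the flavored Schur index of `U(N)` as a power series in `x` whose
coefficients are Laurent polynomials in `b`, valid on the whole domain `|b x| < 1`,
`|b⁻¹ x| < 1` on which the exponent of the matrix integral converges. Such an `A` is unique,
since a power series in `x` is determined by its sum near `x = 0`, and a Laurent polynomial by
its values. -/
def IsExpansion (N : ℕ) (A : PartitionSeries) : Prop :=
  ∀ (x : ℂ) (b : ℂˣ), ‖(b : ℂ) * x‖ < 1 → ‖(b : ℂ)⁻¹ * x‖ < 1 →
    HasSum (fun p : ℕ =>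
      LaurentPolynomial.eval₂ (Int.castRingHom ℂ) b (PowerSeries.coeff p A) * x ^ p)
      (index N x (b : ℂ))

end FlavoredSchur

end

/-!
In the variables `B = b x`, `C = b⁻¹ x` the matrix integral is a function on the bidisc
`|B|, |C| < 1`, and the theorem follows from an integer power series expansion there together with
Cauchy's estimates on the tori `|B| = |C| = exp (-1 / N)`.

*Integrality.* One of the two conjugate Vandermonde determinants may be replaced by `N!` times a
single monomial, since the rest of the integrand is symmetric (`integral_vandermonde_mul`). The
plethystic exponential is the infinite product of
`(1 - (BC)^(k+1) z)² / ((1 - B (BC)^k z) (1 - C (BC)^k z))`, with `z` running over the ratios of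
eigenvalues, hence a locally bounded limit of polynomials with integer coefficients
(`tendsto_truncPair`, `norm_truncPair_le`). Averaging over the torus keeps the coefficients
integral, and a limit of integers is an integer (`exists_int_series_of_tendsto`).

*Growth.* On the torus of radius `r` one has `|a_ij| ≤ r^(-(i+j)) max |I_N|`, and for
`r = exp (-1 / N)`, `i + j ≤ α N²` the first factor is at most `exp (α N)`. It remains to see that
`max |I_N|` is `exp (O (N log N))` (`norm_bidiscIndex_le`). With `p_n` the power sums of the
eigenvalues, the integrand has modulus
`exp (∑ (1/n) (Re ι_n - 1) |p_n|²)`, up to the divergent self-energy of the `N` eigenvalues, and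
`Re ι_n ≤ 1` everywhere on the bidisc because `1 - ι_n` is the inverse of
`(1 - B^n)⁻¹ + (1 - C^n)⁻¹ - 1`, whose real part is nonnegative (`re_letter_le_one`). So only the
self-energy matters. Replacing the Vandermonde coefficients `1` by `ρ^n` with
`ρ = exp (-1 / N⁵)` makes it finite, at the price of a factor `(1 - ρ)^(-N) = exp (O (N log N))`
and of an error that is `O (N)` by the exponential decay of `ι_n` (`norm_integrand_le`).
-/

noncomputable section

namespace FlavoredSchur

open MeasureTheory Filter Topology
open Finset.HasAntidiagonal (antidiagonal mem_antidiagonal sigmaAntidiagonalEquivProd)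

/-! ### Characters of the torus -/

/-- The point `exp (2 π i t)` of the unit circle. -/
def circlePoint (t : ℝ) : ℂ := Complex.exp (2 * Real.pi * Complex.I * t)

/-- The cube `[-1/2, 1/2]^ι`, a fundamental domain of the torus. -/
abbrev cube (ι : Type*) : Set (ι → ℝ) := Set.Icc (fun _ => -(1 / 2 : ℝ)) (fun _ => (1 / 2 : ℝ))

lemma norm_circlePoint (t : ℝ) : ‖circlePoint t‖ = 1 := by
  rw [circlePoint, show (2 * Real.pi * Complex.I * t : ℂ) =
    ((2 * Real.pi * t : ℝ) : ℂ) * Complex.I by push_cast; ring]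
  exact Complex.norm_exp_ofReal_mul_I _

lemma circlePoint_ne_zero (t : ℝ) : circlePoint t ≠ 0 := Complex.exp_ne_zero _

@[fun_prop]
lemma continuous_circlePoint : Continuous circlePoint := by
  unfold circlePoint; fun_prop

lemma circlePoint_sub (s t : ℝ) : circlePoint (s - t) = circlePoint s * (circlePoint t)⁻¹ := by
  rw [circlePoint, circlePoint, circlePoint, ← Complex.exp_neg, ← Complex.exp_add]
  push_cast; ring_nf

lemma conj_circlePoint (t : ℝ) : (starRingEnd ℂ) (circlePoint t) = (circlePoint t)⁻¹ := by
  rw [Complex.inv_def, Complex.normSq_eq_norm_sq, norm_circlePoint]; simp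

lemma volume_cube (ι : Type*) [Fintype ι] : volume (cube ι) = 1 := by
  rw [cube, Real.volume_Icc_pi]; norm_num

instance isFiniteMeasure_restrict_cube (ι : Type*) [Fintype ι] :
    IsFiniteMeasure (volume.restrict (cube ι)) :=
  ⟨by rw [Measure.restrict_apply_univ, volume_cube]; exact ENNReal.one_lt_top⟩

lemma integrable_cube {ι : Type*} [Fintype ι] {f : (ι → ℝ) → ℂ} (hf : Continuous f) :
    Integrable f (volume.restrict (cube ι)) :=
  hf.continuousOn.integrableOn_compact isCompact_Icc

lemma norm_integral_cube_le {ι : Type*} [Fintype ι] {f : (ι → ℝ) → ℂ} {M : ℝ}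
    (hf : ∀ u, ‖f u‖ ≤ M) : ‖∫ u in cube ι, f u‖ ≤ M := by
  have h := norm_setIntegral_le_of_norm_le_const (μ := volume) (s := cube ι) (f := f) (C := M)
    (by rw [volume_cube]; exact ENNReal.one_lt_top) (fun u _ => hf u)
  simpa [measureReal_def, volume_cube] using h

lemma integral_circlePoint_zpow (m : ℤ) :
    ∫ t in Set.Icc (-(1 / 2 : ℝ)) (1 / 2), circlePoint t ^ m = if m = 0 then 1 else 0 := by
  rw [integral_Icc_eq_integral_Ioc, ← intervalIntegral.integral_of_le (by norm_num)]
  have h : ∀ t : ℝ, circlePoint t ^ m = Complex.exp ((2 * Real.pi * Complex.I * m) * t) := by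
    intro t
    rw [circlePoint, ← Complex.exp_int_mul]; ring_nf
  simp_rw [h]
  split_ifs with hm
  · subst hm; simp; norm_num
  · have hc : (2 * Real.pi * Complex.I * m : ℂ) ≠ 0 := by
      simp [Real.pi_ne_zero, hm]
    rw [integral_exp_mul_complex hc, div_eq_zero_iff, sub_eq_zero]
    left
    rw [Complex.exp_eq_exp_iff_exists_int]
    exact ⟨m, by push_cast; ring⟩

lemma integral_cube_character {ι : Type*} [Fintype ι] (m : ι → ℤ) :
    ∫ u in cube ι, ∏ a, circlePoint (u a) ^ m a = if m = 0 then 1 else 0 := by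
  rw [cube, ← Set.pi_univ_Icc, volume_pi, Measure.restrict_pi_pi,
    integral_fintype_prod_eq_prod (fun a t => circlePoint t ^ m a)]
  simp_rw [integral_circlePoint_zpow]
  split_ifs with hm
  · subst hm; simp
  · obtain ⟨a, ha⟩ := Function.ne_iff.mp hm
    exact Finset.prod_eq_zero (Finset.mem_univ a) (by simpa using ha)

/-! ### Limits of integer polynomials on the bidisc -/

/-- The value at `(B, C)` of the polynomial in two variables with coefficients `a`. -/
def polyEval (a : ℕ × ℕ →₀ ℤ) (B C : ℂ) : ℂ :=
  a.sum fun k n => (n : ℂ) * (B ^ k.1 * C ^ k.2)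

lemma polyEval_eq_tsum (a : ℕ × ℕ →₀ ℤ) (B C : ℂ) :
    polyEval a B C = ∑' k : ℕ × ℕ, (a k : ℂ) * (B ^ k.1 * C ^ k.2) := by
  rw [polyEval, Finsupp.sum, tsum_eq_sum]
  intro k hk
  simp [Finsupp.notMem_support_iff.mp hk]

/-- Cauchy's formula for the coefficients of a polynomial on the torus `|B| = |C| = r`. -/
lemma coeff_mul_pow_eq_integral (a : ℕ × ℕ →₀ ℤ) (r : ℝ) (k : ℕ × ℕ) :
    (a k : ℂ) * (r : ℂ) ^ (k.1 + k.2) =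
      ∫ s in cube (Fin 2), polyEval a (r * circlePoint (s 0)) (r * circlePoint (s 1)) *
        (circlePoint (s 0) ^ (-k.1 : ℤ) * circlePoint (s 1) ^ (-k.2 : ℤ)) := by
  have hterm : ∀ (s : Fin 2 → ℝ) (l : ℕ × ℕ),
      (a l : ℂ) * ((r * circlePoint (s 0)) ^ l.1 * (r * circlePoint (s 1)) ^ l.2) *
        (circlePoint (s 0) ^ (-k.1 : ℤ) * circlePoint (s 1) ^ (-k.2 : ℤ)) =
      (a l : ℂ) * (r : ℂ) ^ (l.1 + l.2) *
        ∏ i, circlePoint (s i) ^ (![(l.1 : ℤ) - k.1, (l.2 : ℤ) - k.2] i) := by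
    intro s l
    rw [Fin.prod_univ_two]
    simp only [Matrix.cons_val_zero, Matrix.cons_val_one]
    rw [sub_eq_add_neg, sub_eq_add_neg, zpow_add₀ (circlePoint_ne_zero _),
      zpow_add₀ (circlePoint_ne_zero _), zpow_natCast, zpow_natCast, mul_pow, mul_pow, pow_add]
    ring
  simp_rw [polyEval, Finsupp.sum, Finset.sum_mul, hterm]
  rw [integral_finsetSum]
  · simp_rw [integral_const_mul, integral_cube_character]
    have hiff : ∀ l : ℕ × ℕ, (![(l.1 : ℤ) - k.1, (l.2 : ℤ) - k.2] = 0) ↔ l = k := by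
      intro l
      rw [funext_iff, Fin.forall_fin_two, Prod.ext_iff]
      simp [sub_eq_zero]
    simp only [hiff, mul_ite, mul_one, mul_zero, Finset.sum_ite_eq']
    split_ifs with hk
    · rfl
    · simp [Finsupp.notMem_support_iff.mp hk]
  · intro l _
    apply integrable_cube
    refine continuous_const.mul (continuous_finsetProd _ fun i _ => ?_)
    exact (continuous_circlePoint.comp (continuous_apply i)).zpow₀ _
      fun s => Or.inl (circlePoint_ne_zero _)

lemma continuous_polyEval (a : ℕ × ℕ →₀ ℤ) :
    Continuous fun p : ℂ × ℂ => polyEval a p.1 p.2 := by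
  unfold polyEval Finsupp.sum; fun_prop

/-- A locally bounded pointwise limit of integer polynomials on the open bidisc is the sum of a
power series with integer coefficients, and these obey Cauchy's estimate. The coefficients of the
approximants converge by Cauchy's formula, and a limit of integers is an integer. -/
theorem exists_int_series_of_tendsto (P : ℕ → (ℕ × ℕ →₀ ℤ)) (f : ℂ → ℂ → ℂ)
    (hlim : ∀ B C : ℂ, ‖B‖ < 1 → ‖C‖ < 1 →
      Tendsto (fun K => polyEval (P K) B C) atTop (𝓝 (f B C)))
    (hbound : ∀ r : ℝ, 0 < r → r < 1 → ∃ M : ℝ, ∀ K, ∀ B C : ℂ, ‖B‖ ≤ r → ‖C‖ ≤ r →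
      ‖polyEval (P K) B C‖ ≤ M) :
    ∃ a : ℕ × ℕ → ℤ,
      (∀ B C : ℂ, ‖B‖ < 1 → ‖C‖ < 1 →
        HasSum (fun k : ℕ × ℕ => (a k : ℂ) * (B ^ k.1 * C ^ k.2)) (f B C)) ∧
      ∀ r M : ℝ, 0 < r → r < 1 → (∀ B C : ℂ, ‖B‖ = r → ‖C‖ = r → ‖f B C‖ ≤ M) →
        ∀ k, |(a k : ℝ)| * r ^ (k.1 + k.2) ≤ M := by
  have hnorm : ∀ (r : ℝ), 0 < r → ∀ t, ‖(r : ℂ) * circlePoint t‖ = r := by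
    intro r hr t; simp [norm_circlePoint, abs_of_pos hr]
  have hchar : ∀ (k : ℕ × ℕ) (s : Fin 2 → ℝ),
      ‖circlePoint (s 0) ^ (-k.1 : ℤ) * circlePoint (s 1) ^ (-k.2 : ℤ)‖ = 1 := by
    intro k s; simp [norm_circlePoint]
  let J : ℝ → ℕ × ℕ → ℂ := fun r k =>
    ∫ s in cube (Fin 2), f (r * circlePoint (s 0)) (r * circlePoint (s 1)) *
        (circlePoint (s 0) ^ (-k.1 : ℤ) * circlePoint (s 1) ^ (-k.2 : ℤ))
  have hJ : ∀ r : ℝ, 0 < r → r < 1 → ∀ k,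
      Tendsto (fun K => (P K k : ℂ) * (r : ℂ) ^ (k.1 + k.2)) atTop (𝓝 (J r k)) := by
    intro r hr hr1 k
    simp_rw [coeff_mul_pow_eq_integral]
    obtain ⟨M, hM⟩ := hbound r hr hr1
    refine tendsto_integral_of_dominated_convergence (fun _ => M) ?_ (integrable_const _) ?_ ?_
    · intro K
      apply Continuous.aestronglyMeasurable
      refine Continuous.mul ?_ (Continuous.mul ?_ ?_)
      · exact (continuous_polyEval (P K)).comp (f := fun s : Fin 2 → ℝ =>
          ((r : ℂ) * circlePoint (s 0), (r : ℂ) * circlePoint (s 1))) (by fun_prop)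
      · exact (continuous_circlePoint.comp (continuous_apply 0)).zpow₀ _
          fun s => Or.inl (circlePoint_ne_zero _)
      · exact (continuous_circlePoint.comp (continuous_apply 1)).zpow₀ _
          fun s => Or.inl (circlePoint_ne_zero _)
    · intro K
      refine Eventually.of_forall fun s => ?_
      rw [norm_mul, hchar, mul_one]
      exact hM K _ _ (hnorm r hr _).le (hnorm r hr _).le
    · refine Eventually.of_forall fun s => ?_
      refine Tendsto.mul_const _ (hlim _ _ ?_ ?_) <;> rwa [hnorm r hr]
  -- Any one radius shows convergence of the coefficients, which do not depend on the radius.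
  have hlimit : ∀ k, ∃ n : ℤ, Tendsto (fun K => (P K k : ℂ)) atTop (𝓝 (n : ℂ)) := by
    intro k
    have h := (hJ (1 / 2) (by norm_num) (by norm_num) k).mul_const
      ((((1 / 2 : ℝ) : ℂ) ^ (k.1 + k.2))⁻¹)
    have h0 : (((1 / 2 : ℝ) : ℂ) ^ (k.1 + k.2)) ≠ 0 := pow_ne_zero _ (by norm_num)
    simp_rw [mul_assoc, mul_inv_cancel₀ h0, mul_one] at h
    obtain ⟨n, hn⟩ := Complex.isClosed_range_intCast.mem_of_tendsto h
      (Eventually.of_forall fun K => ⟨P K k, rfl⟩)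
    exact ⟨n, hn ▸ h⟩
  choose a ha using hlimit
  have haJ : ∀ r : ℝ, 0 < r → r < 1 → ∀ k, (a k : ℂ) * (r : ℂ) ^ (k.1 + k.2) = J r k :=
    fun r hr hr1 k => tendsto_nhds_unique ((ha k).mul_const _) (hJ r hr hr1 k)
  refine ⟨a, ?_, ?_⟩
  · intro B C hB hC
    obtain ⟨r, hr, hr1⟩ := exists_between (max_lt hB hC)
    have hBr : ‖B‖ < r := (le_max_left _ _).trans_lt hr
    have hCr : ‖C‖ < r := (le_max_right _ _).trans_lt hr
    have hr0 : 0 < r := (norm_nonneg _).trans_lt hBr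
    obtain ⟨M, hM⟩ := hbound r hr0 hr1
    have hcoef : ∀ K k, ‖(P K k : ℂ)‖ * r ^ (k.1 + k.2) ≤ M := by
      intro K k
      have : ‖(P K k : ℂ) * (r : ℂ) ^ (k.1 + k.2)‖ ≤ M := by
        rw [coeff_mul_pow_eq_integral]
        refine norm_integral_cube_le fun s => ?_
        rw [norm_mul, hchar, mul_one]
        exact hM K _ _ (hnorm r hr0 _).le (hnorm r hr0 _).le
      simpa [abs_of_pos hr0] using this
    let bd : ℕ × ℕ → ℝ := fun k => M * ((‖B‖ / r) ^ k.1 * (‖C‖ / r) ^ k.2)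
    have hbd : Summable bd := by
      apply Summable.mul_left
      exact (summable_geometric_of_lt_one (by positivity) ((div_lt_one hr0).2 hBr)).mul_of_nonneg
        (summable_geometric_of_lt_one (by positivity) ((div_lt_one hr0).2 hCr))
        (fun _ => by positivity) (fun _ => by positivity)
    have hle : ∀ K k, ‖(P K k : ℂ) * (B ^ k.1 * C ^ k.2)‖ ≤ bd k := by
      intro K k
      have := mul_le_mul_of_nonneg_right (hcoef K k)
        (show 0 ≤ (‖B‖ / r) ^ k.1 * (‖C‖ / r) ^ k.2 by positivity)
      refine le_trans (le_of_eq ?_) this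
      rw [norm_mul, norm_mul, norm_pow, norm_pow, div_pow, div_pow, pow_add]
      field_simp
    have hT := tendsto_tsum_of_dominated_convergence (𝓕 := atTop)
      (f := fun K k => (P K k : ℂ) * (B ^ k.1 * C ^ k.2))
      (g := fun k => (a k : ℂ) * (B ^ k.1 * C ^ k.2)) hbd
      (fun k => (ha k).mul_const _) (Eventually.of_forall hle)
    simp_rw [← polyEval_eq_tsum] at hT
    rw [tendsto_nhds_unique (hlim B C hB hC) hT]
    refine Summable.hasSum (Summable.of_norm_bounded hbd fun k => ?_)
    exact le_of_tendsto ((ha k).mul_const (B ^ k.1 * C ^ k.2)).norm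
      (Eventually.of_forall fun K => hle K k)
  · intro r M hr hr1 hM k
    have : ‖(a k : ℂ) * (r : ℂ) ^ (k.1 + k.2)‖ ≤ M := by
      rw [haJ r hr hr1]
      refine norm_integral_cube_le fun s => ?_
      rw [norm_mul, hchar, mul_one]
      exact hM _ _ (hnorm r hr _) (hnorm r hr _)
    simpa [abs_of_pos hr] using this

/-! ### Integer trigonometric polynomials -/

/-- The multiplicative monoid of the functions `B ^ i * C ^ j * ∏ a, exp (2 π i m_a u_a)`
of `(B, C, u)`, with `i, j ≥ 0` and `m_a ∈ ℤ`. -/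
def monomials (ι : Type*) [Fintype ι] : Submonoid (ℂ × ℂ × (ι → ℝ) → ℂ) where
  carrier := {g | ∃ (k : ℕ × ℕ) (m : ι → ℤ),
    g = fun p => p.1 ^ k.1 * p.2.1 ^ k.2 * ∏ a, circlePoint (p.2.2 a) ^ m a}
  one_mem' := ⟨0, 0, by ext p; simp⟩
  mul_mem' := by
    rintro _ _ ⟨k, m, rfl⟩ ⟨k', m', rfl⟩
    refine ⟨k + k', m + m', ?_⟩
    ext p
    simp only [Pi.mul_apply, Pi.add_apply, Prod.fst_add, Prod.snd_add, pow_add,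
      zpow_add₀ (circlePoint_ne_zero _), Finset.prod_mul_distrib]
    ring

/-- The ring of polynomials in `B`, `C` and the `exp (± 2 π i u_a)` with integer coefficients,
as functions of `(B, C, u)`. -/
def trigPolynomials (ι : Type*) [Fintype ι] : Subring (ℂ × ℂ × (ι → ℝ) → ℂ) :=
  Subring.closure (monomials ι : Set _)

lemma polyEval_add (a b : ℕ × ℕ →₀ ℤ) (B C : ℂ) :
    polyEval (a + b) B C = polyEval a B C + polyEval b B C :=
  Finsupp.sum_add_index' (by simp) (by intros; push_cast; ring)

lemma polyEval_neg (a : ℕ × ℕ →₀ ℤ) (B C : ℂ) : polyEval (-a) B C = -polyEval a B C := by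
  rw [eq_neg_iff_add_eq_zero, ← polyEval_add, neg_add_cancel]
  simp [polyEval]

/-- Averaging over the torus turns an integer trigonometric polynomial into an integer
polynomial in `B` and `C`. -/
lemma exists_integral_eq_polyEval {ι : Type*} [Fintype ι] {g : ℂ × ℂ × (ι → ℝ) → ℂ}
    (hg : g ∈ trigPolynomials ι) :
    (∀ B C, Continuous fun u => g (B, C, u)) ∧
      ∃ a : ℕ × ℕ →₀ ℤ, ∀ B C, ∫ u in cube ι, g (B, C, u) = polyEval a B C := by
  rw [trigPolynomials, Subring.mem_closure_iff, Submonoid.closure_eq] at hg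
  induction hg using AddSubgroup.closure_induction with
  | mem g hg =>
    obtain ⟨k, m, rfl⟩ := hg
    refine ⟨fun B C => ?_, ?_⟩
    · change Continuous fun u : ι → ℝ => B ^ k.1 * C ^ k.2 * ∏ a, circlePoint (u a) ^ m a
      refine continuous_const.mul (continuous_finsetProd _ fun a _ => ?_)
      exact (continuous_circlePoint.comp (continuous_apply a)).zpow₀ _
        fun s => Or.inl (circlePoint_ne_zero _)
    · simp_rw [integral_const_mul, integral_cube_character]
      by_cases hm : m = 0
      · exact ⟨Finsupp.single k 1, fun B C => by simp [hm, polyEval]⟩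
      · exact ⟨0, fun B C => by simp [hm, polyEval]⟩
  | zero => exact ⟨fun _ _ => continuous_const, 0, fun B C => by simp [polyEval]⟩
  | add g h _ _ hg hh =>
    obtain ⟨hgc, a, ha⟩ := hg
    obtain ⟨hhc, b, hb⟩ := hh
    refine ⟨fun B C => (hgc B C).add (hhc B C), a + b, fun B C => ?_⟩
    simp only [Pi.add_apply]
    rw [integral_add (integrable_cube (hgc B C)) (integrable_cube (hhc B C)), ha, hb,
      polyEval_add]
  | neg g _ hg =>
    obtain ⟨hgc, a, ha⟩ := hg
    refine ⟨fun B C => (hgc B C).neg, -a, fun B C => ?_⟩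
    simp only [Pi.neg_apply]
    rw [integral_neg, ha, polyEval_neg]

section Membership

variable {ι : Type*} [Fintype ι]

lemma fst_mem_trigPolynomials : (fun p => p.1) ∈ trigPolynomials ι :=
  Subring.subset_closure ⟨(1, 0), 0, by ext p; simp⟩

lemma snd_mem_trigPolynomials : (fun p => p.2.1) ∈ trigPolynomials ι :=
  Subring.subset_closure ⟨(0, 1), 0, by ext p; simp⟩

lemma zpow_mem_trigPolynomials (a : ι) (n : ℤ) :
    (fun p => circlePoint (p.2.2 a) ^ n) ∈ trigPolynomials ι := by
  classical
  refine Subring.subset_closure ⟨(0, 0), Pi.single a n, ?_⟩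
  ext p
  rw [Finset.prod_eq_single a]
  · simp
  · intro b _ hb; simp [hb]
  · simp

end Membership

/-! ### The plethystic exponential of the single-letter index -/

/-- The single-letter index in the variables `B = b x`, `C = b⁻¹ x`. -/
def letter (B C : ℂ) : ℂ := (B + C - 2 * (B * C)) / (1 - B * C)

/-- The plethystic logarithm of the contribution of one pair of eigenvalues of ratio `z`. -/
def pairExponent (B C z : ℂ) : ℂ :=
  ∑' n : ℕ, letter (B ^ (n + 1)) (C ^ (n + 1)) * (z ^ (n + 1) / ((n : ℂ) + 1))

/-- The truncated geometric series `1 + y + ⋯ + y ^ (K - 1)`. -/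
def truncGeom (K : ℕ) (y : ℂ) : ℂ := ∑ j ∈ Finset.range K, y ^ j

/-- A polynomial approximation to `exp (pairExponent B C z)`, which equals the infinite product
of `(1 - (BC)^(k+1) z)² / ((1 - B (BC)^k z) (1 - C (BC)^k z))` over `k ≥ 0`: only `K` factors are
kept, and the geometric series in them are cut off. -/
def truncPair (K : ℕ) (B C z : ℂ) : ℂ :=
  ∏ k ∈ Finset.range K, (1 - (B * C) ^ (k + 1) * z) ^ 2 *
    (truncGeom K (B * (B * C) ^ k * z) * truncGeom K (C * (B * C) ^ k * z))

lemma truncPair_mem_trigPolynomials {ι : Type*} [Fintype ι] (K : ℕ) (a c : ι) :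
    (fun p => truncPair K p.1 p.2.1 (circlePoint (p.2.2 a - p.2.2 c))) ∈ trigPolynomials ι := by
  have hB := fst_mem_trigPolynomials (ι := ι)
  have hC := snd_mem_trigPolynomials (ι := ι)
  have hz : (fun p : ℂ × ℂ × (ι → ℝ) => circlePoint (p.2.2 a - p.2.2 c)) ∈ trigPolynomials ι := by
    convert mul_mem (zpow_mem_trigPolynomials a 1) (zpow_mem_trigPolynomials c (-1)) using 1
    ext p
    simp [circlePoint_sub]
  have hG : ∀ y ∈ trigPolynomials ι, (∑ j ∈ Finset.range K, y ^ j) ∈ trigPolynomials ι :=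
    fun y hy => sum_mem fun j _ => pow_mem hy j
  have := prod_mem (S := trigPolynomials ι) (t := Finset.range K) fun k _ =>
    mul_mem (pow_mem (sub_mem (one_mem _) (mul_mem (pow_mem (mul_mem hB hC) (k + 1)) hz)) 2)
      (mul_mem (hG _ (mul_mem (mul_mem hB (pow_mem (mul_mem hB hC) k)) hz))
        (hG _ (mul_mem (mul_mem hC (pow_mem (mul_mem hB hC) k)) hz)))
  convert this using 1
  ext p
  simp [truncPair, truncGeom, Finset.prod_apply, Finset.sum_apply]

section Estimates

variable {B C z : ℂ} {r : ℝ}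

lemma norm_truncGeom_le (K : ℕ) {y : ℂ} (hr : r < 1) (hy : ‖y‖ ≤ r) :
    ‖truncGeom K y‖ ≤ Real.exp (‖y‖ / (1 - r)) := by
  have h1 : ‖y‖ < 1 := hy.trans_lt hr
  have h2 : ‖truncGeom K y‖ ≤ (1 - ‖y‖)⁻¹ := by
    refine (norm_sum_le _ _).trans ?_
    simp_rw [norm_pow]
    rw [← tsum_geometric_of_lt_one (norm_nonneg y) h1]
    exact (summable_geometric_of_lt_one (norm_nonneg y) h1).sum_le_tsum _
      fun _ _ => by positivity
  refine h2.trans ?_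
  have h3 : (1 - ‖y‖)⁻¹ = ‖y‖ / (1 - ‖y‖) + 1 := by
    have : 1 - ‖y‖ ≠ 0 := by linarith
    field_simp; ring
  rw [h3]
  refine (Real.add_one_le_exp _).trans (Real.exp_le_exp.2 ?_)
  have : 0 < 1 - r := by linarith
  gcongr

lemma norm_mul_le_of_norm_le (hr : r < 1) (hB : ‖B‖ ≤ r) (hC : ‖C‖ ≤ r) : ‖B * C‖ ≤ r := by
  rw [norm_mul]
  nlinarith [norm_nonneg B, norm_nonneg C]

lemma norm_mul_pow_mul_le (hr : r < 1) (hB : ‖B‖ ≤ r) (hC : ‖C‖ ≤ r) (hz : ‖z‖ = 1)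
    {X : ℂ} (hX : ‖X‖ ≤ r) (k : ℕ) : ‖X * (B * C) ^ k * z‖ ≤ r ^ (k + 1) := by
  have hr0 : 0 ≤ r := (norm_nonneg _).trans hB
  have hBC := norm_mul_le_of_norm_le hr hB hC
  rw [norm_mul, norm_mul, hz, mul_one, norm_pow, pow_succ']
  gcongr

lemma norm_truncPair_le (K : ℕ) (hr : r < 1) (hB : ‖B‖ ≤ r) (hC : ‖C‖ ≤ r) (hz : ‖z‖ = 1) :
    ‖truncPair K B C z‖ ≤ Real.exp (2 * (1 + 1 / (1 - r)) * (1 - r)⁻¹) := by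
  have hr0 : 0 ≤ r := (norm_nonneg _).trans hB
  have hr1 : 0 < 1 - r := by linarith
  have hpow : ∀ k : ℕ, r ^ (k + 1) ≤ r := fun k => by
    rw [pow_succ']; exact mul_le_of_le_one_right hr0 (pow_le_one₀ hr0 hr.le)
  have hfac : ∀ k : ℕ, ‖(1 - (B * C) ^ (k + 1) * z) ^ 2 *
      (truncGeom K (B * (B * C) ^ k * z) * truncGeom K (C * (B * C) ^ k * z))‖ ≤
      Real.exp (2 * (1 + 1 / (1 - r)) * r ^ k) := by
    intro k
    have hk : r ^ (k + 1) ≤ r ^ k := by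
      rw [pow_succ]; exact mul_le_of_le_one_right (by positivity) hr.le
    have h1 : ‖1 - (B * C) ^ (k + 1) * z‖ ≤ Real.exp (r ^ k) := by
      have h : ‖(B * C) ^ (k + 1) * z‖ ≤ r ^ k := by
        have := norm_mul_pow_mul_le hr hB hC hz (norm_mul_le_of_norm_le hr hB hC) k
        rw [pow_succ']
        exact this.trans hk
      calc ‖1 - (B * C) ^ (k + 1) * z‖ ≤ ‖(1 : ℂ)‖ + ‖(B * C) ^ (k + 1) * z‖ := norm_sub_le _ _
        _ ≤ r ^ k + 1 := by rw [norm_one]; linarith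
        _ ≤ _ := Real.add_one_le_exp _
    have hG : ∀ X : ℂ, ‖X‖ ≤ r → ‖truncGeom K (X * (B * C) ^ k * z)‖ ≤
        Real.exp (r ^ k / (1 - r)) := by
      intro X hX
      have h := norm_mul_pow_mul_le hr hB hC hz hX k
      refine (norm_truncGeom_le K hr (h.trans (hpow k))).trans (Real.exp_le_exp.2 ?_)
      gcongr
      exact h.trans hk
    rw [norm_mul, norm_mul, norm_pow]
    calc _ ≤ Real.exp (r ^ k) ^ 2 * (Real.exp (r ^ k / (1 - r)) * Real.exp (r ^ k / (1 - r))) := by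
          gcongr
          · exact hG B hB
          · exact hG C hC
      _ = _ := by
          rw [← Real.exp_add, ← Real.exp_nat_mul, ← Real.exp_add]
          congr 1; push_cast; ring
  rw [truncPair, norm_prod]
  refine (Finset.prod_le_prod (fun _ _ => norm_nonneg _) fun k _ => hfac k).trans ?_
  rw [← Real.exp_sum, ← Finset.mul_sum]
  refine Real.exp_le_exp.2 ?_
  gcongr
  rw [← tsum_geometric_of_lt_one hr0 hr]
  exact (summable_geometric_of_lt_one hr0 hr).sum_le_tsum _ fun _ _ => by positivity

lemma norm_letter_pow_le (hr : r < 1) (hB : ‖B‖ ≤ r) (hC : ‖C‖ ≤ r) (n : ℕ) :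
    ‖letter (B ^ (n + 1)) (C ^ (n + 1))‖ ≤ 4 * r ^ (n + 1) / (1 - r) := by
  have hr0 : 0 ≤ r := (norm_nonneg _).trans hB
  have hr1 : 0 < 1 - r := by linarith
  have hBn : ‖B ^ (n + 1)‖ ≤ r ^ (n + 1) := by rw [norm_pow]; gcongr
  have hCn : ‖C ^ (n + 1)‖ ≤ r ^ (n + 1) := by rw [norm_pow]; gcongr
  have hqn : ‖B ^ (n + 1) * C ^ (n + 1)‖ ≤ r ^ (n + 1) := by
    rw [← mul_pow, norm_pow]
    have := norm_mul_le_of_norm_le hr hB hC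
    gcongr
  have hpow : r ^ (n + 1) ≤ r := by
    rw [pow_succ']; exact mul_le_of_le_one_right hr0 (pow_le_one₀ hr0 hr.le)
  rw [letter, norm_div]
  gcongr
  · calc _ ≤ ‖B ^ (n + 1)‖ + ‖C ^ (n + 1)‖ + ‖2 * (B ^ (n + 1) * C ^ (n + 1))‖ :=
          (norm_sub_le _ _).trans (by gcongr; exact norm_add_le _ _)
      _ ≤ _ := by rw [norm_mul 2, Complex.norm_ofNat]; linarith
  · have := norm_sub_norm_le (1 : ℂ) (B ^ (n + 1) * C ^ (n + 1))
    rw [norm_one] at this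
    linarith

lemma norm_pairTerm_le (hr : r < 1) (hB : ‖B‖ ≤ r) (hC : ‖C‖ ≤ r) (hz : ‖z‖ = 1) (n : ℕ) :
    ‖letter (B ^ (n + 1)) (C ^ (n + 1)) * (z ^ (n + 1) / ((n : ℂ) + 1))‖ ≤
      4 / (1 - r) * r ^ (n + 1) := by
  have hr0 : 0 ≤ r := (norm_nonneg _).trans hB
  have hr1 : 0 < 1 - r := by linarith
  have h : ‖z ^ (n + 1) / ((n : ℂ) + 1)‖ ≤ 1 := by
    rw [norm_div, norm_pow, hz, one_pow, ← Nat.cast_succ, Complex.norm_natCast]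
    refine div_le_one_of_le₀ ?_ (by positivity)
    exact_mod_cast Nat.succ_le_succ n.zero_le
  rw [norm_mul]
  calc _ ≤ 4 * r ^ (n + 1) / (1 - r) * 1 := by
        gcongr
        exact norm_letter_pow_le hr hB hC n
    _ = _ := by ring

lemma summable_pow_succ (hr0 : 0 ≤ r) (hr : r < 1) (c : ℝ) :
    Summable fun n : ℕ => c * r ^ (n + 1) :=
  ((summable_nat_add_iff 1).2 (summable_geometric_of_lt_one hr0 hr)).mul_left c

lemma summable_pairTerm (hB : ‖B‖ < 1) (hC : ‖C‖ < 1) (hz : ‖z‖ = 1) :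
    Summable fun n : ℕ => letter (B ^ (n + 1)) (C ^ (n + 1)) * (z ^ (n + 1) / ((n : ℂ) + 1)) := by
  have hr : max ‖B‖ ‖C‖ < 1 := max_lt hB hC
  exact Summable.of_norm_bounded (summable_pow_succ (le_max_of_le_left (norm_nonneg _)) hr _)
    (norm_pairTerm_le hr (le_max_left _ _) (le_max_right _ _) hz)

lemma hasSum_neg_log_one_sub {y : ℂ} (hy : ‖y‖ < 1) :
    HasSum (fun n : ℕ => y ^ (n + 1) / ((n : ℂ) + 1)) (-Complex.log (1 - y)) := by
  have h := (hasSum_nat_add_iff' 1).2 (Complex.hasSum_taylorSeries_neg_log hy)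
  simpa using h

lemma one_sub_ne_zero_of_norm_lt_one {y : ℂ} (hy : ‖y‖ < 1) : 1 - y ≠ 0 := by
  intro h
  rw [← sub_eq_zero.1 h, norm_one] at hy
  exact lt_irrefl _ hy

/-- The finite product of exact factors, as the exponential of the partial sums over `k` of the
plethystic exponent; the geometric sum over `k` only contributes `1 - (BC)^(nK)`. -/
lemma prod_factor_eq_exp (K : ℕ) (hB : ‖B‖ < 1) (hC : ‖C‖ < 1) (hz : ‖z‖ = 1) :
    ∏ k ∈ Finset.range K, (1 - (B * C) ^ (k + 1) * z) ^ 2 *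
      ((1 - B * (B * C) ^ k * z)⁻¹ * (1 - C * (B * C) ^ k * z)⁻¹) =
    Complex.exp (∑' n : ℕ, letter (B ^ (n + 1)) (C ^ (n + 1)) * (z ^ (n + 1) / ((n : ℂ) + 1)) *
      (1 - ((B * C) ^ (n + 1)) ^ K)) := by
  have hr : max ‖B‖ ‖C‖ < 1 := max_lt hB hC
  have hpow : ∀ k : ℕ, max ‖B‖ ‖C‖ ^ (k + 1) < 1 := fun k =>
    pow_lt_one₀ (le_max_of_le_left (norm_nonneg _)) hr (Nat.succ_ne_zero k)
  have hq := norm_mul_le_of_norm_le hr (le_max_left ‖B‖ ‖C‖) (le_max_right ‖B‖ ‖C‖)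
  have hlt : ∀ X : ℂ, ‖X‖ ≤ max ‖B‖ ‖C‖ → ∀ k, ‖X * (B * C) ^ k * z‖ < 1 := fun X hX k =>
    (norm_mul_pow_mul_le hr (le_max_left _ _) (le_max_right _ _) hz hX k).trans_lt (hpow k)
  have hqlt : ∀ k : ℕ, ‖(B * C) ^ (k + 1) * z‖ < 1 := fun k => by
    rw [pow_succ']; exact hlt _ hq k
  have hsum : ∀ k ∈ Finset.range K, HasSum (fun n : ℕ =>
      (B * (B * C) ^ k * z) ^ (n + 1) / ((n : ℂ) + 1) +
        (C * (B * C) ^ k * z) ^ (n + 1) / ((n : ℂ) + 1) -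
        2 * (((B * C) ^ (k + 1) * z) ^ (n + 1) / ((n : ℂ) + 1)))
      (-Complex.log (1 - B * (B * C) ^ k * z) + -Complex.log (1 - C * (B * C) ^ k * z) -
        2 * -Complex.log (1 - (B * C) ^ (k + 1) * z)) := fun k _ =>
    ((hasSum_neg_log_one_sub (hlt B (le_max_left _ _) k)).add
      (hasSum_neg_log_one_sub (hlt C (le_max_right _ _) k))).sub
      ((hasSum_neg_log_one_sub (hqlt k)).mul_left 2)
  have hterm : ∀ n : ℕ, ∑ k ∈ Finset.range K, ((B * (B * C) ^ k * z) ^ (n + 1) / ((n : ℂ) + 1) +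
        (C * (B * C) ^ k * z) ^ (n + 1) / ((n : ℂ) + 1) -
        2 * (((B * C) ^ (k + 1) * z) ^ (n + 1) / ((n : ℂ) + 1))) =
      letter (B ^ (n + 1)) (C ^ (n + 1)) * (z ^ (n + 1) / ((n : ℂ) + 1)) *
        (1 - ((B * C) ^ (n + 1)) ^ K) := by
    intro n
    have hqn : 1 - (B * C) ^ (n + 1) ≠ 0 := by
      apply one_sub_ne_zero_of_norm_lt_one
      rw [norm_pow]
      exact pow_lt_one₀ (norm_nonneg _) (hq.trans_lt hr) (Nat.succ_ne_zero n)
    have hgeom : ∑ k ∈ Finset.range K, ((B * C) ^ (n + 1)) ^ k =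
        (1 - ((B * C) ^ (n + 1)) ^ K) / (1 - (B * C) ^ (n + 1)) := by
      rw [eq_div_iff hqn, geom_sum_mul_neg]
    have : ∀ k : ℕ, (B * (B * C) ^ k * z) ^ (n + 1) / ((n : ℂ) + 1) +
        (C * (B * C) ^ k * z) ^ (n + 1) / ((n : ℂ) + 1) -
        2 * (((B * C) ^ (k + 1) * z) ^ (n + 1) / ((n : ℂ) + 1)) =
        (B ^ (n + 1) + C ^ (n + 1) - 2 * (B * C) ^ (n + 1)) * (z ^ (n + 1) / ((n : ℂ) + 1)) *
          ((B * C) ^ (n + 1)) ^ k := by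
      intro k
      generalize B * C = q
      ring
    simp_rw [this]
    rw [← Finset.mul_sum, hgeom, letter, ← mul_pow]
    field_simp
  have hS := hasSum_sum hsum
  simp_rw [hterm] at hS
  rw [hS.tsum_eq, Complex.exp_sum]
  refine Finset.prod_congr rfl fun k _ => ?_
  have h1 := one_sub_ne_zero_of_norm_lt_one (hlt B (le_max_left _ _) k)
  have h2 := one_sub_ne_zero_of_norm_lt_one (hlt C (le_max_right _ _) k)
  have h3 := one_sub_ne_zero_of_norm_lt_one (hqlt k)
  rw [show ∀ a b c : ℂ, -a + -b - 2 * -c = c + c + (-a + -b) by intros; ring, Complex.exp_add,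
    Complex.exp_add, Complex.exp_add, Complex.exp_neg, Complex.exp_neg, Complex.exp_log h1,
    Complex.exp_log h2, Complex.exp_log h3]
  ring

lemma tendsto_prod_one_sub_pow {X : ℂ} (hB : ‖B‖ ≤ r) (hC : ‖C‖ ≤ r) (hX : ‖X‖ ≤ r)
    (hr : r < 1) (hz : ‖z‖ = 1) :
    Tendsto (fun K : ℕ => ∏ k ∈ Finset.range K, (1 - (X * (B * C) ^ k * z) ^ K)) atTop (𝓝 1) := by
  have hr0 : 0 ≤ r := (norm_nonneg _).trans hB
  rw [tendsto_iff_norm_sub_tendsto_zero]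
  have hlim : Tendsto (fun K : ℕ => Real.exp (K * r ^ K) - 1) atTop (𝓝 0) := by
    have h := (Real.continuous_exp.tendsto 0).comp
      (tendsto_self_mul_const_pow_of_lt_one hr0 hr)
    rw [Real.exp_zero] at h
    simpa using h.sub_const 1
  refine squeeze_zero (fun _ => norm_nonneg _) (fun K => ?_) hlim
  have h := Finset.norm_prod_one_add_sub_one_le (Finset.range K)
    fun k => -(X * (B * C) ^ k * z) ^ K
  simp_rw [← sub_eq_add_neg] at h
  refine h.trans ?_
  gcongr
  calc ∑ k ∈ Finset.range K, ‖-(X * (B * C) ^ k * z) ^ K‖ ≤ ∑ k ∈ Finset.range K, r ^ K := by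
        refine Finset.sum_le_sum fun k _ => ?_
        rw [norm_neg, norm_pow]
        refine pow_le_pow_left₀ (norm_nonneg _) ?_ K
        refine (norm_mul_pow_mul_le hr hB hC hz hX k).trans ?_
        rw [pow_succ']
        exact mul_le_of_le_one_right hr0 (pow_le_one₀ hr0 hr.le)
    _ = _ := by simp

lemma tendsto_truncPair (hB : ‖B‖ < 1) (hC : ‖C‖ < 1) (hz : ‖z‖ = 1) :
    Tendsto (fun K => truncPair K B C z) atTop (𝓝 (Complex.exp (pairExponent B C z))) := by
  set r := max ‖B‖ ‖C‖ with hrdef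
  have hr : r < 1 := max_lt hB hC
  have hBr : ‖B‖ ≤ r := le_max_left _ _
  have hCr : ‖C‖ ≤ r := le_max_right _ _
  have hr0 : 0 ≤ r := (norm_nonneg _).trans hBr
  have hqr := norm_mul_le_of_norm_le hr hBr hCr
  have hlt : ∀ X : ℂ, ‖X‖ ≤ r → ∀ k, ‖X * (B * C) ^ k * z‖ < 1 := fun X hX k =>
    (norm_mul_pow_mul_le hr hBr hCr hz hX k).trans_lt
      (pow_lt_one₀ hr0 hr (Nat.succ_ne_zero k))
  have hgeom : ∀ K : ℕ, ∀ y : ℂ, ‖y‖ < 1 → truncGeom K y = (1 - y)⁻¹ * (1 - y ^ K) := by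
    intro K y hy
    rw [inv_mul_eq_div, eq_div_iff (one_sub_ne_zero_of_norm_lt_one hy), truncGeom,
      geom_sum_mul_neg]
  have hsplit : ∀ K, truncPair K B C z =
      Complex.exp (∑' n : ℕ, letter (B ^ (n + 1)) (C ^ (n + 1)) * (z ^ (n + 1) / ((n : ℂ) + 1)) *
        (1 - ((B * C) ^ (n + 1)) ^ K)) *
      ((∏ k ∈ Finset.range K, (1 - (B * (B * C) ^ k * z) ^ K)) *
        ∏ k ∈ Finset.range K, (1 - (C * (B * C) ^ k * z) ^ K)) := by
    intro K
    rw [← prod_factor_eq_exp K hB hC hz, ← Finset.prod_mul_distrib, ← Finset.prod_mul_distrib,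
      truncPair]
    refine Finset.prod_congr rfl fun k _ => ?_
    rw [hgeom K _ (hlt B hBr k), hgeom K _ (hlt C hCr k)]
    ring
  have hmain : Tendsto (fun K : ℕ => ∑' n : ℕ, letter (B ^ (n + 1)) (C ^ (n + 1)) *
      (z ^ (n + 1) / ((n : ℂ) + 1)) * (1 - ((B * C) ^ (n + 1)) ^ K)) atTop
      (𝓝 (pairExponent B C z)) := by
    refine tendsto_tsum_of_dominated_convergence
      (summable_pow_succ hr0 hr (4 / (1 - r) * 2)) (fun n => ?_) (Eventually.of_forall ?_)
    · have hq : ‖(B * C) ^ (n + 1)‖ < 1 := by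
        rw [norm_pow]
        exact pow_lt_one₀ (norm_nonneg _) (hqr.trans_lt hr) (Nat.succ_ne_zero n)
      have h := ((tendsto_pow_atTop_nhds_zero_of_norm_lt_one hq).const_sub 1).const_mul
        (letter (B ^ (n + 1)) (C ^ (n + 1)) * (z ^ (n + 1) / ((n : ℂ) + 1)))
      simpa using h
    · intro K n
      rw [norm_mul]
      have h1 := norm_pairTerm_le hr hBr hCr hz n
      have h2 : ‖1 - ((B * C) ^ (n + 1)) ^ K‖ ≤ 2 := by
        refine (norm_sub_le _ _).trans ?_
        rw [norm_one, norm_pow, norm_pow]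
        have : (‖B * C‖ ^ (n + 1)) ^ K ≤ 1 :=
          pow_le_one₀ (by positivity) (pow_le_one₀ (norm_nonneg _) (hqr.trans hr.le))
        linarith
      calc _ ≤ (4 / (1 - r) * r ^ (n + 1)) * 2 := by
            have : 0 < 1 - r := by linarith
            gcongr
        _ = _ := by ring
  have := ((Complex.continuous_exp.tendsto _).comp hmain).mul
    ((tendsto_prod_one_sub_pow hBr hCr hBr hr hz).mul (tendsto_prod_one_sub_pow hBr hCr hCr hr hz))
  rw [mul_one, mul_one] at this
  refine this.congr fun K => ?_
  rw [hsplit]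
  rfl

end Estimates

/-! ### Symmetrization of the matrix integral -/

/-- The Vandermonde determinant of the eigenvalues `exp (2 π i u_a)`. -/
def eigenvalueDet {N : ℕ} (u : Fin N → ℝ) : ℂ :=
  (Matrix.vandermonde fun a => circlePoint (u a)).det

lemma circlePoint_sub_mul_conj (s t : ℝ) :
    (circlePoint t - circlePoint s) * (starRingEnd ℂ) (circlePoint t - circlePoint s) =
      (((2 * Real.sin (Real.pi * (s - t))) ^ 2 : ℝ) : ℂ) := by
  have hz : ∀ t : ℝ, circlePoint t = Complex.exp (Real.pi * t * Complex.I) ^ 2 := by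
    intro t
    rw [circlePoint, ← Complex.exp_nat_mul]; push_cast; ring_nf
  rw [map_sub, conj_circlePoint, conj_circlePoint, hz, hz]
  push_cast
  rw [Complex.sin, mul_sub (Real.pi : ℂ), neg_sub, sub_mul (Real.pi * t : ℂ),
    sub_mul (Real.pi * s : ℂ), Complex.exp_sub, Complex.exp_sub]
  have h1 := Complex.exp_ne_zero (Real.pi * s * Complex.I)
  have h2 := Complex.exp_ne_zero (Real.pi * t * Complex.I)
  generalize Complex.exp (Real.pi * s * Complex.I) = w at *
  generalize Complex.exp (Real.pi * t * Complex.I) = v at *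
  field_simp
  rw [Complex.I_sq]
  ring

lemma vandermonde_eq_eigenvalueDet_mul_conj {N : ℕ} (u : Fin N → ℝ) :
    (vandermonde N u : ℂ) = eigenvalueDet u * (starRingEnd ℂ) (eigenvalueDet u) := by
  rw [eigenvalueDet, Matrix.det_vandermonde, map_prod, ← Finset.prod_mul_distrib, vandermonde,
    Complex.ofReal_prod]
  refine Finset.prod_congr rfl fun a _ => ?_
  rw [map_prod, ← Finset.prod_mul_distrib, Complex.ofReal_prod]
  exact Finset.prod_congr rfl fun c _ => (circlePoint_sub_mul_conj _ _).symm

lemma continuous_eigenvalueDet {N : ℕ} : Continuous fun u : Fin N → ℝ => eigenvalueDet u := by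
  simp_rw [eigenvalueDet, Matrix.det_vandermonde]
  fun_prop

lemma eigenvalueDet_comp_perm {N : ℕ} (σ : Equiv.Perm (Fin N)) (u : Fin N → ℝ) :
    eigenvalueDet (u ∘ σ) = (Equiv.Perm.sign σ : ℤ) * eigenvalueDet u := by
  rw [eigenvalueDet, eigenvalueDet, ← Matrix.det_permute]
  rfl

lemma integral_cube_comp_perm {N : ℕ} (σ : Equiv.Perm (Fin N)) (g : (Fin N → ℝ) → ℂ) :
    ∫ u in cube (Fin N), g (u ∘ σ) = ∫ u in cube (Fin N), g u := by
  let Φ := MeasurableEquiv.piCongrLeft (fun _ : Fin N => ℝ) σ.symm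
  have hΦ : ∀ u, Φ u = u ∘ σ := by
    intro u
    ext i
    have := MeasurableEquiv.piCongrLeft_apply_apply (β := fun _ : Fin N => ℝ) σ.symm u (σ i)
    simpa using this
  have hpre : Φ ⁻¹' cube (Fin N) = cube (Fin N) := by
    ext u
    simp only [Set.mem_preimage, hΦ, cube, Set.mem_Icc, Pi.le_def, Function.comp_apply]
    rw [σ.forall_congr_right (q := fun i => -(1 / 2 : ℝ) ≤ u i),
      σ.forall_congr_right (q := fun i => u i ≤ (1 / 2 : ℝ))]
  have h := (volume_measurePreserving_piCongrLeft (fun _ : Fin N => ℝ)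
    σ.symm).setIntegral_preimage_emb Φ.measurableEmbedding g (cube (Fin N))
  change ∫ u in Φ ⁻¹' cube (Fin N), g (Φ u) = _ at h
  rw [hpre] at h
  simpa only [hΦ] using h

/-- Against a symmetric function the squared Vandermonde determinant may be replaced by `N!` times
the determinant and one conjugate term of its Leibniz expansion: the `N!` terms of the conjugate
determinant contribute equally. This removes the denominator `N!`. -/
theorem integral_vandermonde_mul {N : ℕ} (f : (Fin N → ℝ) → ℂ) (hf : Continuous f)
    (hsymm : ∀ (σ : Equiv.Perm (Fin N)) u, f (u ∘ σ) = f u) :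
    (1 / (N ! : ℂ)) * ∫ u in cube (Fin N), (vandermonde N u : ℂ) * f u =
      ∫ u in cube (Fin N), eigenvalueDet u * (∏ i, circlePoint (u i) ^ (-(i : ℕ) : ℤ)) * f u := by
  set g : (Fin N → ℝ) → ℂ := fun u =>
    eigenvalueDet u * (∏ i, circlePoint (u i) ^ (-(i : ℕ) : ℤ)) * f u with hg
  have hgc : Continuous g := by
    refine (continuous_eigenvalueDet.mul (continuous_finsetProd _ fun i _ => ?_)).mul hf
    exact (continuous_circlePoint.comp (continuous_apply i)).zpow₀ _
      fun s => Or.inl (circlePoint_ne_zero _)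
  have hexp : ∀ u, (vandermonde N u : ℂ) * f u = ∑ σ : Equiv.Perm (Fin N), g (u ∘ σ) := by
    intro u
    rw [vandermonde_eq_eigenvalueDet_mul_conj]
    have hconj : (starRingEnd ℂ) (eigenvalueDet u) = ∑ σ : Equiv.Perm (Fin N),
        ((Equiv.Perm.sign σ : ℤ) : ℂ) * ∏ i, circlePoint (u (σ i)) ^ (-(i : ℕ) : ℤ) := by
      rw [eigenvalueDet, Matrix.det_apply', map_sum]
      refine Finset.sum_congr rfl fun σ _ => ?_
      rw [map_mul, map_prod, map_intCast]
      congr 1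
      refine Finset.prod_congr rfl fun i _ => ?_
      rw [Matrix.vandermonde_apply, map_pow, conj_circlePoint, zpow_neg, zpow_natCast, inv_pow]
    rw [hconj, Finset.mul_sum, Finset.sum_mul]
    refine Finset.sum_congr rfl fun σ _ => ?_
    simp only [hg, eigenvalueDet_comp_perm, hsymm, Function.comp_apply]
    ring
  simp_rw [hexp]
  rw [integral_finsetSum]
  · simp_rw [integral_cube_comp_perm _ g]
    rw [Finset.sum_const, Finset.card_univ, Fintype.card_perm, Fintype.card_fin, nsmul_eq_mul,
      ← mul_assoc, one_div_mul_cancel (Nat.cast_ne_zero.2 (Nat.factorial_ne_zero N)), one_mul]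
  · intro σ _
    exact integrable_cube (hgc.comp (by fun_prop))

/-! ### The index as a function on the bidisc -/

/-- The product over all pairs of eigenvalues of the plethystic exponentials. -/
def pairProduct {N : ℕ} (B C : ℂ) (u : Fin N → ℝ) : ℂ :=
  Complex.exp (∑ a, ∑ c, pairExponent B C (circlePoint (u a - u c)))

lemma pairProduct_eq_prod {N : ℕ} (B C : ℂ) (u : Fin N → ℝ) :
    pairProduct B C u =
      ∏ a, ∏ c, Complex.exp (pairExponent B C (circlePoint (u a - u c))) := by
  simp_rw [pairProduct, Complex.exp_sum]

lemma continuous_pairProduct {N : ℕ} {B C : ℂ} (hB : ‖B‖ < 1) (hC : ‖C‖ < 1) :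
    Continuous fun u : Fin N → ℝ => pairProduct B C u := by
  have hr : max ‖B‖ ‖C‖ < 1 := max_lt hB hC
  have h : Continuous fun t : ℝ => pairExponent B C (circlePoint t) :=
    continuous_tsum (fun n => by fun_prop)
      (summable_pow_succ (le_max_of_le_left (norm_nonneg _)) hr _) fun n t =>
      norm_pairTerm_le hr (le_max_left _ _) (le_max_right _ _) (norm_circlePoint t) n
  refine Complex.continuous_exp.comp (continuous_finsetSum _ fun a _ =>
    continuous_finsetSum _ fun c _ => ?_)
  exact h.comp (f := fun u : Fin N → ℝ => u a - u c) (by fun_prop)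

lemma pairProduct_comp_perm {N : ℕ} (B C : ℂ) (σ : Equiv.Perm (Fin N)) (u : Fin N → ℝ) :
    pairProduct B C (u ∘ σ) = pairProduct B C u := by
  simp only [pairProduct, Function.comp_apply]
  congr 1
  rw [← Equiv.sum_comp σ fun a => ∑ c, pairExponent B C (circlePoint (u a - u c))]
  refine Finset.sum_congr rfl fun a _ => ?_
  exact Equiv.sum_comp σ fun c => pairExponent B C (circlePoint (u (σ a) - u c))

/-- The flavored Schur index as a function of `B = b x` and `C = b⁻¹ x`. -/
def bidiscIndex (N : ℕ) (B C : ℂ) : ℂ :=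
  (1 / (N ! : ℂ)) * ∫ u in cube (Fin N), (vandermonde N u : ℂ) * pairProduct B C u

lemma singleLetter_pow {x b : ℂ} (hb : b ≠ 0) (hB : ‖b * x‖ < 1) (hC : ‖b⁻¹ * x‖ < 1) (n : ℕ) :
    singleLetter (x ^ (n + 1)) (b ^ (n + 1)) =
      letter ((b * x) ^ (n + 1)) ((b⁻¹ * x) ^ (n + 1)) := by
  have hP : b ^ (n + 1) * x ^ (n + 1) = (b * x) ^ (n + 1) := (mul_pow _ _ _).symm
  have hQ : (b ^ (n + 1))⁻¹ * x ^ (n + 1) = (b⁻¹ * x) ^ (n + 1) := by rw [mul_pow, inv_pow]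
  have hPQ : (x ^ (n + 1)) ^ 2 = (b * x) ^ (n + 1) * (b⁻¹ * x) ^ (n + 1) := by
    rw [← mul_pow, ← pow_mul, mul_comm (n + 1) 2, pow_mul]
    congr 1
    field_simp
  have hne : 1 - (b * x) ^ (n + 1) * (b⁻¹ * x) ^ (n + 1) ≠ 0 := by
    apply one_sub_ne_zero_of_norm_lt_one
    rw [← mul_pow, norm_pow, norm_mul]
    exact pow_lt_one₀ (by positivity) (mul_lt_one_of_nonneg_of_lt_one_left (norm_nonneg _) hB hC.le)
      (Nat.succ_ne_zero n)
  rw [singleLetter, letter, hP, hQ, hPQ, eq_div_iff hne, sub_mul, div_mul_cancel₀ _ hne]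
  ring

lemma index_eq_bidiscIndex (N : ℕ) {x b : ℂ} (hb : b ≠ 0) (hB : ‖b * x‖ < 1)
    (hC : ‖b⁻¹ * x‖ < 1) : index N x b = bidiscIndex N (b * x) (b⁻¹ * x) := by
  have hexp : ∀ u : Fin N → ℝ, exponent N x b u =
      ∑ a, ∑ c, pairExponent (b * x) (b⁻¹ * x) (circlePoint (u a - u c)) := by
    intro u
    have hs := fun a c => summable_pairTerm hB hC (norm_circlePoint (u a - u c))
    simp_rw [pairExponent]
    simp_rw [← (Summable.tsum_finsetSum fun c _ => hs _ c)]
    rw [← Summable.tsum_finsetSum fun a _ => summable_sum fun c _ => hs a c, exponent]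
    refine tsum_congr fun n => ?_
    rw [singleLetter_pow hb hB hC, Finset.mul_sum]
    refine Finset.sum_congr rfl fun a _ => ?_
    rw [Finset.mul_sum]
    refine Finset.sum_congr rfl fun c _ => ?_
    have : Complex.exp (2 * Real.pi * Complex.I * ((n : ℂ) + 1) * ((u a - u c : ℝ) : ℂ)) =
        circlePoint (u a - u c) ^ (n + 1) := by
      rw [circlePoint, ← Complex.exp_nat_mul]; push_cast; ring_nf
    rw [this]
    ring
  simp_rw [index, bidiscIndex, pairProduct, hexp]

lemma norm_eigenvalueDet_le {N : ℕ} (u : Fin N → ℝ) :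
    ‖eigenvalueDet u‖ ≤ ∏ a : Fin N, ∏ _c ∈ Finset.Ioi a, (2 : ℝ) := by
  rw [eigenvalueDet, Matrix.det_vandermonde, norm_prod]
  refine Finset.prod_le_prod (fun _ _ => norm_nonneg _) fun a _ => ?_
  rw [norm_prod]
  refine Finset.prod_le_prod (fun _ _ => norm_nonneg _) fun c _ => ?_
  refine (norm_sub_le _ _).trans ?_
  rw [norm_circlePoint, norm_circlePoint]
  norm_num

/-- The index is the sum of an integer power series on the bidisc. After symmetrization it is a
limit of torus averages of integer trigonometric polynomials. -/
theorem exists_int_series_bidiscIndex (N : ℕ) :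
    ∃ a : ℕ × ℕ → ℤ,
      (∀ B C : ℂ, ‖B‖ < 1 → ‖C‖ < 1 →
        HasSum (fun k : ℕ × ℕ => (a k : ℂ) * (B ^ k.1 * C ^ k.2)) (bidiscIndex N B C)) ∧
      ∀ r M : ℝ, 0 < r → r < 1 →
        (∀ B C : ℂ, ‖B‖ = r → ‖C‖ = r → ‖bidiscIndex N B C‖ ≤ M) →
        ∀ k, |(a k : ℝ)| * r ^ (k.1 + k.2) ≤ M := by
  let w : (Fin N → ℝ) → ℂ := fun u => eigenvalueDet u * ∏ i, circlePoint (u i) ^ (-(i : ℕ) : ℤ)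
  let g : ℕ → ℂ × ℂ × (Fin N → ℝ) → ℂ := fun K p =>
    w p.2.2 * ∏ a, ∏ c, truncPair K p.1 p.2.1 (circlePoint (p.2.2 a - p.2.2 c))
  have hgmem : ∀ K, g K ∈ trigPolynomials (Fin N) := by
    intro K
    have hz : ∀ a : Fin N, (fun p : ℂ × ℂ × (Fin N → ℝ) => circlePoint (p.2.2 a)) ∈
        trigPolynomials (Fin N) := fun a => by
      simpa using zpow_mem_trigPolynomials a 1
    have := mul_mem (mul_mem
      (prod_mem (S := trigPolynomials (Fin N)) (t := Finset.univ) fun a _ =>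
        prod_mem (t := Finset.Ioi a) fun c _ => sub_mem (hz c) (hz a))
      (prod_mem (t := Finset.univ) fun (i : Fin N) _ =>
        zpow_mem_trigPolynomials i (-(i : ℕ) : ℤ)))
      (prod_mem (t := Finset.univ) fun a _ => prod_mem (t := Finset.univ) fun c _ =>
        truncPair_mem_trigPolynomials K a c)
    convert this using 1
    ext p
    simp only [g, w, eigenvalueDet, Matrix.det_vandermonde, Pi.mul_apply, Finset.prod_apply,
      Pi.sub_apply]
  choose hgc P hP using fun K => exists_integral_eq_polyEval (hgmem K)
  have hw : ∀ u, ‖w u‖ ≤ ∏ a : Fin N, ∏ _c ∈ Finset.Ioi a, (2 : ℝ) := by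
    intro u
    rw [norm_mul, norm_prod]
    simpa [norm_circlePoint] using norm_eigenvalueDet_le u
  have hgb : ∀ r : ℝ, r < 1 → ∃ M : ℝ, ∀ K, ∀ B C : ℂ, ‖B‖ ≤ r → ‖C‖ ≤ r → ∀ u,
      ‖g K (B, C, u)‖ ≤ M := by
    intro r hr
    refine ⟨(∏ a : Fin N, ∏ _c ∈ Finset.Ioi a, (2 : ℝ)) * ∏ _a : Fin N, ∏ _c : Fin N,
      Real.exp (2 * (1 + 1 / (1 - r)) * (1 - r)⁻¹), fun K B C hB hC u => ?_⟩
    simp only [g]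
    rw [norm_mul, norm_prod]
    refine mul_le_mul (hw u) (Finset.prod_le_prod (fun _ _ => norm_nonneg _) fun a _ => ?_)
      (by positivity) (by positivity)
    rw [norm_prod]
    exact Finset.prod_le_prod (fun _ _ => norm_nonneg _) fun c _ =>
      norm_truncPair_le K hr hB hC (norm_circlePoint _)
  refine exists_int_series_of_tendsto P (bidiscIndex N) (fun B C hB hC => ?_)
    fun r _ hr => ?_
  · rw [bidiscIndex, integral_vandermonde_mul _ (continuous_pairProduct hB hC)
      (pairProduct_comp_perm B C)]
    simp_rw [← hP]
    obtain ⟨M, hM⟩ := hgb _ (max_lt hB hC)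
    refine tendsto_integral_of_dominated_convergence (fun _ => M)
      (fun K => (hgc K B C).aestronglyMeasurable) (integrable_const _)
      (fun K => Eventually.of_forall fun u => hM K B C (le_max_left _ _) (le_max_right _ _) u)
      (Eventually.of_forall fun u => ?_)
    rw [pairProduct_eq_prod]
    exact tendsto_const_nhds.mul (tendsto_finsetProd _ fun a _ => tendsto_finsetProd _ fun c _ =>
      tendsto_truncPair hB hC (norm_circlePoint _))
  · obtain ⟨M, hM⟩ := hgb r hr
    refine ⟨M, fun K B C hB hC => ?_⟩
    rw [← hP]
    exact norm_integral_cube_le fun u => hM K B C hB hC u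

/-! ### An upper bound for the index near the boundary of the bidisc -/

lemma half_le_re_inv_one_sub {B : ℂ} (hB : ‖B‖ < 1) : 1 / 2 ≤ ((1 - B)⁻¹).re := by
  have hpos : 0 < Complex.normSq (1 - B) :=
    Complex.normSq_pos.2 (one_sub_ne_zero_of_norm_lt_one hB)
  have hB2 : B.re * B.re + B.im * B.im < 1 := by
    rw [← Complex.normSq_apply, Complex.normSq_eq_norm_sq]
    exact pow_lt_one₀ (norm_nonneg _) hB two_ne_zero
  rw [Complex.inv_re, le_div_iff₀ hpos, Complex.normSq_apply]
  simp only [Complex.sub_re, Complex.one_re, Complex.sub_im, Complex.one_im]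
  nlinarith

/-- Positivity of the effective repulsion between eigenvalues: the Vandermonde interaction, which
has all Fourier coefficients equal to `1`, outweighs the single-letter index. Indeed
`1 - letter B C = (1 - B) (1 - C) / (1 - B C)` is the inverse of
`(1 - B)⁻¹ + (1 - C)⁻¹ - 1`, and each inverse has real part at least `1/2`. -/
lemma re_letter_le_one {B C : ℂ} (hB : ‖B‖ < 1) (hC : ‖C‖ < 1) : (letter B C).re ≤ 1 := by
  have hBC : ‖B * C‖ < 1 := by
    rw [norm_mul]; exact mul_lt_one_of_nonneg_of_lt_one_left (norm_nonneg _) hB hC.le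
  have h1 := one_sub_ne_zero_of_norm_lt_one hB
  have h2 := one_sub_ne_zero_of_norm_lt_one hC
  have h3 := one_sub_ne_zero_of_norm_lt_one hBC
  have h : letter B C = 1 - ((1 - B)⁻¹ + (1 - C)⁻¹ - 1)⁻¹ := by
    have : (1 - B)⁻¹ + (1 - C)⁻¹ - 1 = (1 - B * C) / ((1 - B) * (1 - C)) := by
      field_simp; ring
    rw [this, letter, inv_div]
    field_simp
    ring
  have hre : 0 ≤ ((1 - B)⁻¹ + (1 - C)⁻¹ - 1).re := by
    have := half_le_re_inv_one_sub hB
    have := half_le_re_inv_one_sub hC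
    simp only [Complex.add_re, Complex.sub_re, Complex.one_re]
    linarith
  rw [h, Complex.sub_re, Complex.one_re, Complex.inv_re]
  have := div_nonneg hre (Complex.normSq_nonneg ((1 - B)⁻¹ + (1 - C)⁻¹ - 1))
  linarith

lemma norm_one_sub_mul_circlePoint_sq (ρ s : ℝ) :
    ‖1 - ρ * circlePoint s‖ ^ 2 = 1 + ρ ^ 2 - 2 * ρ * Real.cos (2 * Real.pi * s) := by
  have h : circlePoint s = ⟨Real.cos (2 * Real.pi * s), Real.sin (2 * Real.pi * s)⟩ := by
    rw [circlePoint, show (2 * Real.pi * Complex.I * s : ℂ) =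
      ((2 * Real.pi * s : ℝ) : ℂ) * Complex.I by push_cast; ring]
    apply Complex.ext
    · rw [Complex.exp_ofReal_mul_I_re]
    · rw [Complex.exp_ofReal_mul_I_im]
  rw [← Complex.normSq_eq_norm_sq, h, Complex.normSq_apply]
  simp
  nlinarith [Real.sin_sq_add_cos_sq (2 * Real.pi * s)]

/-- Moving the singularity of one Vandermonde factor slightly off the unit circle. -/
lemma four_sin_sq_mul_le {ρ : ℝ} (s t : ℝ) :
    (2 * Real.sin (Real.pi * (s - t))) ^ 2 * ρ ≤
      ‖1 - ρ * circlePoint (t - s)‖ * ‖1 - ρ * circlePoint (s - t)‖ := by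
  have h1 := norm_one_sub_mul_circlePoint_sq ρ (s - t)
  have h2 := norm_one_sub_mul_circlePoint_sq ρ (t - s)
  rw [show 2 * Real.pi * (t - s) = -(2 * Real.pi * (s - t)) by ring, Real.cos_neg, ← h1,
    sq_eq_sq₀ (norm_nonneg _) (norm_nonneg _)] at h2
  have hcos : Real.cos (2 * Real.pi * (s - t)) = 1 - 2 * Real.sin (Real.pi * (s - t)) ^ 2 := by
    rw [mul_assoc, Real.cos_two_mul, Real.cos_sq']; ring
  rw [h2, ← sq, h1, hcos]
  nlinarith [sq_nonneg (1 - ρ)]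

lemma vandermonde_nonneg (N : ℕ) (u : Fin N → ℝ) : 0 ≤ vandermonde N u :=
  Finset.prod_nonneg fun _ _ => Finset.prod_nonneg fun _ _ => sq_nonneg _

/-- Regularization of the Vandermonde factor. The diagonal pairs, absent on the left, cost the
factor `(1 - ρ) ^ N` on the right. -/
lemma vandermonde_mul_le (N : ℕ) {ρ : ℝ} (h0 : 0 < ρ) (h1 : ρ < 1) (u : Fin N → ℝ) :
    vandermonde N u * (ρ ^ N ^ 2 * (1 - ρ) ^ N) ≤
      ∏ a, ∏ c, ‖1 - ρ * circlePoint (u a - u c)‖ := by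
  set f : Fin N → Fin N → ℝ := fun a c => ‖1 - ρ * circlePoint (u c - u a)‖ with hf
  have hfn : ∀ a c, 0 ≤ f a c := fun a c => norm_nonneg _
  have hdiag : ∀ a, f a a = 1 - ρ := by
    intro a
    have : circlePoint (u a - u a) = 1 := by simp [circlePoint]
    simp only [hf, this, mul_one]
    rw [← Complex.ofReal_one, ← Complex.ofReal_sub, Complex.norm_real, Real.norm_of_nonneg]
    linarith
  have hoff : vandermonde N u * ρ ^ N ^ 2 ≤ ∏ a, ∏ c ∈ {a}ᶜ, f c a := by
    rw [← Finset.prod_prod_Ioi_mul_eq_prod_prod_off_diag]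
    have hρ : ρ ^ N ^ 2 ≤ ∏ a : Fin N, ∏ _c ∈ Finset.Ioi a, ρ := by
      rw [sq, pow_mul]
      calc (ρ ^ N) ^ N = ∏ _a : Fin N, ρ ^ N := by simp
        _ ≤ _ := by
          refine Finset.prod_le_prod (fun _ _ => by positivity) fun a _ => ?_
          rw [Finset.prod_const]
          refine pow_le_pow_of_le_one h0.le h1.le ?_
          simpa using Finset.card_le_univ (Finset.Ioi a)
    refine (mul_le_mul_of_nonneg_left hρ (vandermonde_nonneg N u)).trans ?_
    rw [vandermonde, ← Finset.prod_mul_distrib]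
    refine Finset.prod_le_prod (fun a _ => ?_) fun a _ => ?_
    · exact mul_nonneg (Finset.prod_nonneg fun _ _ => sq_nonneg _)
        (Finset.prod_nonneg fun _ _ => h0.le)
    · rw [← Finset.prod_mul_distrib]
      refine Finset.prod_le_prod (fun c _ => by positivity) fun c _ => ?_
      rw [mul_comm (f c a)]
      exact four_sin_sq_mul_le (u a) (u c)
  have hall : ∏ a, ∏ c, f c a = (1 - ρ) ^ N * ∏ a, ∏ c ∈ {a}ᶜ, f c a := by
    rw [Finset.prod_congr rfl fun a _ => Fintype.prod_eq_mul_prod_compl a fun c => f c a,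
      Finset.prod_mul_distrib]
    simp [hdiag]
  change _ ≤ ∏ a, ∏ c, f c a
  rw [hall, ← mul_assoc, mul_comm ((1 - ρ) ^ N)]
  exact mul_le_mul_of_nonneg_right hoff (pow_nonneg (by linarith) N)

lemma norm_one_sub_eq_exp {y : ℂ} (hy : ‖y‖ < 1) :
    ‖1 - y‖ = Real.exp (-(∑' n : ℕ, y ^ (n + 1) / ((n : ℂ) + 1)).re) := by
  rw [(hasSum_neg_log_one_sub hy).tsum_eq, Complex.neg_re, neg_neg, ← Complex.norm_exp,
    Complex.exp_log (one_sub_ne_zero_of_norm_lt_one hy)]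

/-- The power sum of the ratios of the eigenvalues is a squared modulus. -/
lemma sum_sum_circlePoint_pow {N : ℕ} (u : Fin N → ℝ) (n : ℕ) :
    ∑ a, ∑ c, circlePoint (u a - u c) ^ n =
      ((‖∑ a, circlePoint (u a) ^ n‖ ^ 2 : ℝ) : ℂ) := by
  rw [← Complex.normSq_eq_norm_sq, ← Complex.mul_conj, map_sum, Finset.sum_mul_sum]
  simp_rw [map_pow, conj_circlePoint, circlePoint_sub, mul_pow]

lemma norm_sum_circlePoint_pow_sq_le {N : ℕ} (u : Fin N → ℝ) (n : ℕ) :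
    ‖∑ a, circlePoint (u a) ^ n‖ ^ 2 ≤ (N : ℝ) ^ 2 := by
  refine pow_le_pow_left₀ (norm_nonneg _) ((norm_sum_le _ _).trans ?_) 2
  simp [norm_circlePoint]

/-- If `g n` bounds the part of the `(n + 1)`-st term of the plethystic exponent that is not
compensated by the Vandermonde factor regularized at `ρ`, then the integrand is at most
`exp (N² ∑ g n)` times the cost `ρ ^ (-N²) (1 - ρ) ^ (-N)` of the regularization. Each power sum
of the ratios of eigenvalues is nonnegative and at most `N²`. -/
lemma norm_integrand_le (N : ℕ) {B C : ℂ} (hB : ‖B‖ < 1) (hC : ‖C‖ < 1) {ρ : ℝ} (h0 : 0 < ρ)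
    (h1 : ρ < 1) {g : ℕ → ℝ} (hg0 : ∀ n, 0 ≤ g n) (hg : Summable g)
    (hle : ∀ n : ℕ, ((letter (B ^ (n + 1)) (C ^ (n + 1))).re - ρ ^ (n + 1)) / ((n : ℝ) + 1) ≤ g n)
    (u : Fin N → ℝ) :
    ‖(vandermonde N u : ℂ) * pairProduct B C u‖ * (ρ ^ N ^ 2 * (1 - ρ) ^ N) ≤
      Real.exp ((N : ℝ) ^ 2 * ∑' n, g n) := by
  have hρz : ∀ a c, ‖(ρ : ℂ) * circlePoint (u a - u c)‖ < 1 := by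
    intro a c
    rwa [norm_mul, norm_circlePoint, mul_one, Complex.norm_real, Real.norm_of_nonneg h0.le]
  rw [norm_mul, Complex.norm_real, Real.norm_of_nonneg (vandermonde_nonneg N u), mul_right_comm]
  refine (mul_le_mul_of_nonneg_right (vandermonde_mul_le N h0 h1 u) (norm_nonneg _)).trans ?_
  simp_rw [norm_one_sub_eq_exp (hρz _ _), ← Real.exp_sum]
  rw [pairProduct, Complex.norm_exp, ← Real.exp_add]
  refine Real.exp_le_exp.2 ?_
  have hs := fun a c => (summable_pairTerm hB hC (norm_circlePoint (u a - u c))).hasSum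
  have ht := fun a c => (hasSum_neg_log_one_sub (hρz a c)).summable.hasSum
  have hT := hasSum_sum fun a (_ : a ∈ Finset.univ) => hasSum_sum fun c (_ : c ∈ Finset.univ) =>
    (hs a c).sub (ht a c)
  have hre := Complex.hasSum_re hT
  have hval : (∑ a, ∑ c, -(∑' n : ℕ, ((ρ : ℂ) * circlePoint (u a - u c)) ^ (n + 1) /
      ((n : ℂ) + 1)).re) + (∑ a, ∑ c, pairExponent B C (circlePoint (u a - u c))).re =
      (∑ a, ∑ c, ((∑' n : ℕ, letter (B ^ (n + 1)) (C ^ (n + 1)) *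
        (circlePoint (u a - u c) ^ (n + 1) / ((n : ℂ) + 1))) -
        ∑' n : ℕ, ((ρ : ℂ) * circlePoint (u a - u c)) ^ (n + 1) / ((n : ℂ) + 1))).re := by
    simp_rw [Complex.re_sum, Complex.sub_re, Finset.sum_sub_distrib, Finset.sum_neg_distrib,
      pairExponent]
    ring
  rw [hval, ← hre.tsum_eq, ← tsum_mul_left]
  refine hre.summable.tsum_le_tsum (fun n => ?_) (hg.mul_left _)
  have hterm : ∑ a, ∑ c, (letter (B ^ (n + 1)) (C ^ (n + 1)) *
        (circlePoint (u a - u c) ^ (n + 1) / ((n : ℂ) + 1)) -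
        ((ρ : ℂ) * circlePoint (u a - u c)) ^ (n + 1) / ((n : ℂ) + 1)) =
      (letter (B ^ (n + 1)) (C ^ (n + 1)) - ((ρ ^ (n + 1) : ℝ) : ℂ)) *
        ((‖∑ a, circlePoint (u a) ^ (n + 1)‖ ^ 2 / ((n : ℝ) + 1) : ℝ) : ℂ) := by
    rw [Complex.ofReal_div, ← sum_sum_circlePoint_pow, Finset.sum_div, Finset.mul_sum]
    refine Finset.sum_congr rfl fun a _ => ?_
    rw [Finset.sum_div, Finset.mul_sum]
    refine Finset.sum_congr rfl fun c _ => ?_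
    push_cast
    rw [mul_pow]
    ring
  rw [hterm, Complex.re_mul_ofReal, Complex.sub_re, Complex.ofReal_re]
  calc _ = ‖∑ a, circlePoint (u a) ^ (n + 1)‖ ^ 2 *
        (((letter (B ^ (n + 1)) (C ^ (n + 1))).re - ρ ^ (n + 1)) / ((n : ℝ) + 1)) := by ring
    _ ≤ ‖∑ a, circlePoint (u a) ^ (n + 1)‖ ^ 2 * g n := by gcongr; exact hle n
    _ ≤ (N : ℝ) ^ 2 * g n :=
        mul_le_mul_of_nonneg_right (norm_sum_circlePoint_pow_sq_le u (n + 1)) (hg0 n)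

lemma inv_one_sub_exp_neg_inv_le {y : ℝ} (hy : 0 < y) :
    (1 - Real.exp (-(1 / y)))⁻¹ ≤ y + 1 := by
  have h1 : Real.exp (-(1 / y)) ≤ y / (y + 1) := by
    rw [Real.exp_neg, inv_le_comm₀ (Real.exp_pos _) (by positivity), inv_div]
    refine le_trans (le_of_eq ?_) (Real.add_one_le_exp (1 / y))
    field_simp
    ring
  have h2 : (y + 1)⁻¹ ≤ 1 - Real.exp (-(1 / y)) := by
    have : (y + 1)⁻¹ = 1 - y / (y + 1) := by field_simp; ring
    linarith
  exact inv_le_of_inv_le₀ (by positivity) h2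

/-- The growth of the index at distance about `1 / N` from the boundary of the bidisc is at most
`exp (O (N log N))`. The Vandermonde factor is regularized at `ρ = exp (-1 / N ^ 5)`; the excess
of the `n`-th Fourier coefficient `letter (B ^ n) (C ^ n)` over `ρ ^ n` is at most `n / N ^ 5` by
positivity and at most `8 N r ^ n` by decay, hence at most the geometric mean of the two. -/
theorem norm_bidiscIndex_le {N : ℕ} (hN : 0 < N) {B C : ℂ}
    (hB : ‖B‖ = Real.exp (-(1 / (N : ℝ)))) (hC : ‖C‖ = Real.exp (-(1 / (N : ℝ)))) :
    ‖bidiscIndex N B C‖ ≤ Real.exp (10 * N) * (2 * (N : ℝ) ^ 5) ^ N := by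
  have hN1 : (1 : ℝ) ≤ N := by exact_mod_cast hN
  have hN0 : (0 : ℝ) < N := by linarith
  set r := Real.exp (-(1 / (N : ℝ))) with hr
  set s := Real.exp (-(1 / (2 * (N : ℝ)))) with hs
  set ρ := Real.exp (-(1 / (N : ℝ) ^ 5)) with hρ
  have hlt : ∀ y : ℝ, 0 < y → Real.exp (-(1 / y)) < 1 := fun y hy =>
    Real.exp_lt_one_iff.2 (by have := one_div_pos.2 hy; linarith)
  have hr1 : r < 1 := hlt _ hN0
  have hs1 : s < 1 := hlt _ (by positivity)
  have hρ1 : ρ < 1 := hlt _ (by positivity)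
  have hr0 : 0 < r := Real.exp_pos _
  have hs0 : 0 < s := Real.exp_pos _
  have hρ0 : 0 < ρ := Real.exp_pos _
  -- `s ^ n` is the decay left after taking the geometric mean with a bound that does not decay.
  have hsr : s ^ 2 = r := by
    rw [hs, hr, ← Real.exp_nat_mul]; congr 1; push_cast; field_simp
  have hBlt : ‖B‖ < 1 := hB ▸ hr1
  have hClt : ‖C‖ < 1 := hC ▸ hr1
  have hrinv : (1 - r)⁻¹ ≤ 2 * N := (inv_one_sub_exp_neg_inv_le hN0).trans (by linarith)
  have hsinv : (1 - s)⁻¹ ≤ 3 * N :=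
    (inv_one_sub_exp_neg_inv_le (by positivity : (0 : ℝ) < 2 * N)).trans (by linarith)
  have hρinv : (1 - ρ)⁻¹ ≤ 2 * (N : ℝ) ^ 5 := by
    have := one_le_pow₀ (n := 5) hN1
    exact (inv_one_sub_exp_neg_inv_le (by positivity : (0 : ℝ) < (N : ℝ) ^ 5)).trans (by linarith)
  let g : ℕ → ℝ := fun n => 3 / (N : ℝ) ^ 2 * s ^ n
  have hg : HasSum g (3 / (N : ℝ) ^ 2 * (1 - s)⁻¹) :=
    (hasSum_geometric_of_lt_one hs0.le hs1).mul_left _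
  have hle : ∀ n : ℕ,
      ((letter (B ^ (n + 1)) (C ^ (n + 1))).re - ρ ^ (n + 1)) / ((n : ℝ) + 1) ≤ g n := by
    intro n
    have hn : (0 : ℝ) < (n : ℝ) + 1 := by positivity
    rw [div_le_iff₀ hn]
    set t := (letter (B ^ (n + 1)) (C ^ (n + 1))).re - ρ ^ (n + 1) with ht
    have hpos : 0 ≤ g n * ((n : ℝ) + 1) := by positivity
    rcases le_total t 0 with h | h
    · exact h.trans hpos
    have ht1 : t ≤ ((n : ℝ) + 1) / (N : ℝ) ^ 5 := by
      have h1 : (letter (B ^ (n + 1)) (C ^ (n + 1))).re ≤ 1 := by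
        apply re_letter_le_one <;> rw [norm_pow] <;>
          exact pow_lt_one₀ (norm_nonneg _) (by assumption) (Nat.succ_ne_zero n)
      have h2 : 1 - ((n : ℝ) + 1) / (N : ℝ) ^ 5 ≤ ρ ^ (n + 1) := by
        rw [hρ, ← Real.exp_nat_mul]
        refine le_trans (le_of_eq ?_) (Real.add_one_le_exp _)
        push_cast
        ring
      linarith
    have ht2 : t ≤ 8 * N * s ^ (2 * n) := by
      have h1 : (letter (B ^ (n + 1)) (C ^ (n + 1))).re ≤ 4 * r ^ (n + 1) / (1 - r) :=
        (Complex.re_le_norm _).trans (norm_letter_pow_le hr1 hB.le hC.le n)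
      have h2 : 0 < ρ ^ (n + 1) := by positivity
      have h3 : r ^ (n + 1) ≤ s ^ (2 * n) := by
        rw [pow_mul, hsr, pow_succ]
        exact mul_le_of_le_one_right (by positivity) hr1.le
      have h4 : 4 * r ^ (n + 1) / (1 - r) ≤ 4 * s ^ (2 * n) * (2 * N) := by
        rw [div_eq_mul_inv]
        have : 0 ≤ (1 - r)⁻¹ := inv_nonneg.2 (by linarith)
        gcongr
      linarith
    rw [← pow_le_pow_iff_left₀ h hpos two_ne_zero]
    calc t ^ 2 ≤ ((n : ℝ) + 1) / (N : ℝ) ^ 5 * (8 * N * s ^ (2 * n)) := by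
          rw [sq]; exact mul_le_mul ht1 ht2 h (by positivity)
      _ = 8 * ((n : ℝ) + 1) * (s ^ (2 * n) / (N : ℝ) ^ 4) := by field_simp
      _ ≤ (9 * ((n : ℝ) + 1) ^ 2) * (s ^ (2 * n) / (N : ℝ) ^ 4) := by
          refine mul_le_mul_of_nonneg_right ?_ (by positivity)
          nlinarith [(Nat.cast_nonneg n : (0 : ℝ) ≤ n)]
      _ = (g n * ((n : ℝ) + 1)) ^ 2 := by
          simp only [g]; rw [pow_mul']; field_simp; ring
  have hint : ∀ u : Fin N → ℝ, ‖(vandermonde N u : ℂ) * pairProduct B C u‖ ≤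
      Real.exp (10 * N) * (2 * (N : ℝ) ^ 5) ^ N := by
    intro u
    have h := norm_integrand_le N hBlt hClt hρ0 hρ1 (fun n => by positivity) hg.summable hle u
    rw [hg.tsum_eq] at h
    have h9 : (N : ℝ) ^ 2 * (3 / (N : ℝ) ^ 2 * (1 - s)⁻¹) ≤ 9 * N := by
      have : (N : ℝ) ^ 2 * (3 / (N : ℝ) ^ 2 * (1 - s)⁻¹) = 3 * (1 - s)⁻¹ := by field_simp
      linarith
    have hρN : (ρ ^ N ^ 2)⁻¹ ≤ Real.exp N := by
      rw [hρ, ← Real.exp_nat_mul, ← Real.exp_neg]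
      refine Real.exp_le_exp.2 ?_
      have h1 : -(((N ^ 2 : ℕ) : ℝ) * -(1 / (N : ℝ) ^ 5)) = 1 / (N : ℝ) ^ 3 := by
        push_cast; field_simp
      rw [h1]
      exact (div_le_one_of_le₀ (one_le_pow₀ hN1) (by positivity)).trans hN1
    have hpos : 0 < ρ ^ N ^ 2 * (1 - ρ) ^ N :=
      mul_pos (by positivity) (pow_pos (by linarith) N)
    rw [← le_div_iff₀ hpos, div_eq_mul_inv, mul_inv, ← inv_pow (1 - ρ)] at h
    refine h.trans ?_
    have hinv0 : 0 ≤ (1 - ρ)⁻¹ := inv_nonneg.2 (by linarith)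
    calc _ ≤ Real.exp (9 * N) * (Real.exp N * (2 * (N : ℝ) ^ 5) ^ N) := by gcongr
      _ = _ := by rw [← mul_assoc, ← Real.exp_add]; congr 2; ring
  have hfac : ‖(1 / (N ! : ℂ))‖ ≤ 1 := by
    rw [norm_div, norm_one, Complex.norm_natCast]
    refine div_le_one_of_le₀ ?_ (by positivity)
    exact_mod_cast Nat.factorial_pos N
  rw [bidiscIndex, norm_mul]
  calc _ ≤ 1 * ‖∫ u in cube (Fin N), (vandermonde N u : ℂ) * pairProduct B C u‖ := by gcongr
    _ ≤ _ := by rw [one_mul]; exact norm_integral_cube_le hint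

/-! ### Partition series and cumulative degeneracies -/

/-- The partition series obtained from a power series in `B`, `C` by the substitution
`B = b x`, `C = b⁻¹ x`. -/
def substSeries (a : ℕ × ℕ → ℤ) : PartitionSeries :=
  PowerSeries.mk fun p => ∑ k ∈ antidiagonal p,
    LaurentPolynomial.C (a k) * LaurentPolynomial.T ((k.1 : ℤ) - k.2)

lemma hasSum_substSeries {a : ℕ × ℕ → ℤ} {x S : ℂ} {b : ℂˣ}
    (h : HasSum (fun k : ℕ × ℕ => (a k : ℂ) * ((b * x) ^ k.1 * ((b : ℂ)⁻¹ * x) ^ k.2)) S) :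
    HasSum (fun p : ℕ => LaurentPolynomial.eval₂ (Int.castRingHom ℂ) b
      (PowerSeries.coeff p (substSeries a)) * x ^ p) S := by
  have h' := (sigmaAntidiagonalEquivProd.hasSum_iff.mpr h).sigma fun p =>
    hasSum_fintype _
  convert h' using 1
  ext p
  rw [substSeries, PowerSeries.coeff_mk, map_sum, Finset.sum_mul, ← Finset.sum_coe_sort]
  refine Finset.sum_congr rfl fun k _ => ?_
  obtain ⟨k, hk⟩ := k
  obtain rfl := mem_antidiagonal.1 hk
  have hb : (b : ℂ) ≠ 0 := b.ne_zero
  change _ = (a k : ℂ) * ((b * x) ^ k.1 * ((b : ℂ)⁻¹ * x) ^ k.2)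
  rw [LaurentPolynomial.eval₂_C_mul_T,
    Units.val_zpow_eq_zpow_val, zpow_sub₀ hb, eq_intCast, zpow_natCast, zpow_natCast, mul_pow,
    mul_pow, pow_add, inv_pow]
  field_simp

lemma sum_natAbs_coeff_le (a : ℕ × ℕ → ℤ) (p : ℕ) (s : Finset ℤ) :
    ∑ q ∈ s, ((substSeries a).degeneracy p q).natAbs ≤
      ∑ k ∈ antidiagonal p, (a k).natAbs := by
  have h : ∀ q, ((substSeries a).degeneracy p q).natAbs ≤
      ∑ k ∈ antidiagonal p, if (k.1 : ℤ) - k.2 = q then (a k).natAbs else 0 := by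
    intro q
    rw [PartitionSeries.degeneracy, substSeries, PowerSeries.coeff_mk]
    simp_rw [← LaurentPolynomial.single_eq_C_mul_T]
    rw [AddMonoidAlgebra.coeff_sum, Finset.sum_apply']
    refine (Int.natAbs_sum_le _ _).trans (le_of_eq (Finset.sum_congr rfl fun k _ => ?_))
    rw [AddMonoidAlgebra.coeff_single, Finsupp.single_apply]
    split_ifs <;> simp
  refine (Finset.sum_le_sum fun q _ => h q).trans ?_
  rw [Finset.sum_comm]
  refine Finset.sum_le_sum fun k _ => ?_
  rw [Finset.sum_ite_eq]
  split_ifs <;> simp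

/-- Cauchy's estimates bound the cumulative degeneracies, there being `p + 1` monomials
`B ^ i * C ^ j` of total degree `p`. -/
lemma cumulative_substSeries_le {a : ℕ × ℕ → ℤ} {r M : ℝ} (hr0 : 0 < r) (hr1 : r < 1)
    (h : ∀ k, |(a k : ℝ)| * r ^ (k.1 + k.2) ≤ M) (P : ℕ) :
    ((substSeries a).cumulative P : ℝ) ≤ ((P : ℝ) + 1) ^ 2 * (M * (r ^ P)⁻¹) := by
  have hcoef : ∀ p ≤ P, ∀ k ∈ antidiagonal p, ((a k).natAbs : ℝ) ≤ M * (r ^ P)⁻¹ := by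
    intro p hp k hk
    rw [Nat.cast_natAbs, Int.cast_abs, ← div_eq_mul_inv, le_div_iff₀ (by positivity)]
    refine le_trans ?_ (h k)
    rw [mem_antidiagonal.1 hk]
    exact mul_le_mul_of_nonneg_left (pow_le_pow_of_le_one hr0.le hr1.le hp) (abs_nonneg _)
  have hM : 0 ≤ M * (r ^ P)⁻¹ :=
    (Nat.cast_nonneg _).trans (hcoef 0 P.zero_le (0, 0) (by simp))
  rw [PartitionSeries.cumulative]
  push_cast
  calc _ ≤ ∑ p ∈ Finset.range (P + 1), ((P : ℝ) + 1) * (M * (r ^ P)⁻¹) := by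
        refine Finset.sum_le_sum fun p hp => ?_
        have hpP : p ≤ P := Nat.lt_succ_iff.1 (Finset.mem_range.1 hp)
        have h1 := sum_natAbs_coeff_le a p (PowerSeries.coeff p (substSeries a)).coeff.support
        have h2 : (∑ k ∈ antidiagonal p, ((a k).natAbs : ℝ)) ≤
            ((p : ℝ) + 1) * (M * (r ^ P)⁻¹) := by
          refine (Finset.sum_le_card_nsmul _ _ _ (hcoef p hpP)).trans ?_
          simp
        refine le_trans (by exact_mod_cast h1) (h2.trans ?_)
        gcongr
    _ = _ := by
        rw [Finset.sum_const, Finset.card_range, nsmul_eq_mul]; push_cast; ring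

lemma eventually_const_add_log_lt_rpow (K : ℝ) {ε : ℝ} (hε : 0 < ε) :
    ∀ᶠ N : ℕ in atTop, K + 9 * Real.log N < (N : ℝ) ^ ε := by
  have hK : (fun _ : ℝ => K) =o[atTop] fun x : ℝ => x ^ ε :=
    Asymptotics.isLittleO_const_left.2 (Or.inr
      (tendsto_norm_atTop_atTop.comp (tendsto_rpow_atTop hε)))
  have h := (hK.add ((isLittleO_log_rpow_atTop hε).const_mul_left 9)).bound
    (show (0 : ℝ) < 1 / 2 by norm_num)
  filter_upwards [tendsto_natCast_atTop_atTop.eventually h, eventually_gt_atTop 0] with N hN hN0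
  have hpos : 0 < (N : ℝ) ^ ε := Real.rpow_pos_of_pos (by exact_mod_cast hN0) ε
  rw [Real.norm_of_nonneg hpos.le] at hN
  have := (le_abs_self _).trans hN
  linarith

/-- The Cauchy estimates at radius `exp (-1 / N)`, where the factor `r ^ (-P)` for
`P ≤ α N ^ 2` is only `exp (α N)`, turn an `exp (O (N log N))` bound on the index into
log-linear growth. -/
theorem isLogLinearlyBounded_substSeries (a : ℕ → ℕ × ℕ → ℤ)
    (h : ∀ N : ℕ, 0 < N → ∀ k, |(a N k : ℝ)| * Real.exp (-(1 / (N : ℝ))) ^ (k.1 + k.2) ≤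
      Real.exp (10 * N) * (2 * (N : ℝ) ^ 5) ^ N) :
    PartitionSeries.IsLogLinearlyBounded fun N => substSeries (a N) := by
  intro α ε hα hε
  obtain ⟨N₀, hN₀⟩ := eventually_atTop.1
    (eventually_const_add_log_lt_rpow (2 * Real.log (α + 1) + 11 + α) hε)
  refine ⟨N₀ + 1, N₀.succ_pos, fun N hN => ?_⟩
  have hlarge := hN₀ N (by omega)
  have hNpos : 0 < N := by omega
  have hN1 : (1 : ℝ) ≤ N := by exact_mod_cast hNpos
  have hN0 : (0 : ℝ) < N := by linarith
  have hlogN : 0 ≤ Real.log N := Real.log_nonneg hN1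
  have hlogα : 0 ≤ Real.log (α + 1) := Real.log_nonneg (by linarith)
  set P := ⌊α * (N : ℝ) ^ 2⌋₊ with hP
  have hPle : (P : ℝ) ≤ α * (N : ℝ) ^ 2 := Nat.floor_le (by positivity)
  have hr1 : Real.exp (-(1 / (N : ℝ))) < 1 :=
    Real.exp_lt_one_iff.2 (by have := one_div_pos.2 hN0; linarith)
  have hcum := cumulative_substSeries_le (Real.exp_pos _) hr1 (h N hNpos) P
  rw [Real.rpow_add hN0, Real.rpow_one]
  rcases Nat.eq_zero_or_pos ((substSeries (a N)).cumulative P) with h0 | hpos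
  · rw [h0, Nat.cast_zero, Real.log_zero]
    exact mul_pos hN0 (Real.rpow_pos_of_pos hN0 ε)
  have hrP : (Real.exp (-(1 / (N : ℝ))) ^ P)⁻¹ ≤ Real.exp (α * N) := by
    rw [← Real.exp_nat_mul, ← Real.exp_neg]
    refine Real.exp_le_exp.2 ?_
    have : -((P : ℝ) * -(1 / (N : ℝ))) = P / N := by ring
    rw [this, div_le_iff₀ hN0]
    linarith
  have hP1 : (P : ℝ) + 1 ≤ (α + 1) * (N : ℝ) ^ 2 := by
    have := one_le_pow₀ (n := 2) hN1
    linarith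
  have hbound : ((substSeries (a N)).cumulative P : ℝ) ≤
      ((α + 1) * (N : ℝ) ^ 2) ^ 2 *
        (Real.exp (10 * N) * (2 * (N : ℝ) ^ 5) ^ N * Real.exp (α * N)) := by
    refine hcum.trans ?_
    gcongr
  have hlog := Real.log_le_log (by exact_mod_cast hpos) hbound
  have hα1 : α + 1 ≠ 0 := by positivity
  have hNne : (N : ℝ) ≠ 0 := hN0.ne'
  rw [Real.log_mul (by positivity) (by positivity), Real.log_mul (by positivity) (by positivity),
    Real.log_mul (by positivity) (by positivity), Real.log_exp, Real.log_exp, Real.log_pow,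
    Real.log_pow, Real.log_mul hα1 (by positivity), Real.log_mul (by norm_num) (by positivity),
    Real.log_pow, Real.log_pow] at hlog
  push_cast at hlog
  have hlog2 : Real.log 2 ≤ 1 := by
    have := Real.log_le_sub_one_of_pos (show (0 : ℝ) < 2 by norm_num)
    linarith
  calc _ ≤ _ := hlog
    _ ≤ N * (2 * Real.log (α + 1) + 11 + α + 9 * Real.log N) := by
      nlinarith [mul_nonneg (sub_nonneg.2 hN1) hlogα, mul_nonneg (sub_nonneg.2 hN1) hlogN,
        mul_nonneg hN0.le (sub_nonneg.2 hlog2)]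
    _ < _ := mul_lt_mul_of_pos_left hlarge hN0

end FlavoredSchur

theorem theorem3 :
    ∃ A : ℕ → PartitionSeries,
      (∀ N : ℕ, 0 < N → FlavoredSchur.IsExpansion N (A N)) ∧
      PartitionSeries.IsLogLinearlyBounded A := by
  choose a hsum hcauchy using FlavoredSchur.exists_int_series_bidiscIndex
  refine ⟨fun N => FlavoredSchur.substSeries (a N), fun N _ x b hB hC => ?_,
    FlavoredSchur.isLogLinearlyBounded_substSeries a fun N hN => ?_⟩
  · rw [FlavoredSchur.index_eq_bidiscIndex N b.ne_zero hB hC]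
    exact FlavoredSchur.hasSum_substSeries (hsum N _ _ hB hC)
  · have hpos : (0 : ℝ) < 1 / N := one_div_pos.2 (by exact_mod_cast hN)
    exact hcauchy N _ _ (Real.exp_pos _) (Real.exp_lt_one_iff.2 (by linarith))
      fun B C hB hC => FlavoredSchur.norm_bidiscIndex_le hN hB hC

end
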